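/- Let $f$ be an orientation-preserving $C^2$ diffeomorphism of $[0,1]$ (possibly with fixed points in $(0,1)$). For a $C^2$ diffeomorphism $g$ of $[0,1]$ preserving orientation, let $\mathrm{var}(\log Dg)$ denote the total variation on $[0,1]$ of the logarithm of its derivative $Dg$. Then the asymptotic distortion $$\mathrm{dist}_\infty(f) := \lim_{n\to\infty} \frac{1}{n}\,\mathrm{var}(\log Df^n),$$ where $f^n$ is the $n$-th iterate of $f$, exists and is finite. Moreover, $\mathrm{dist}_\infty(f)=0$ if and only if $f$ is the time-$1$ map of the flow on $[0,1]$ of a $C^1$ vector field $X$ on $[0,1]$ that is $C^1$-flat at each of its zeros, that is, $DX(p)=0$ for every $p\in[0,1]$ with $X(p)=0$ (derivatives at $0$ and $1$ are one-sided). -/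

import Mathlib

open Set Filter Topology

namespace IntervalDiffeo

/-- `f` restricts to an orientation-preserving `C^r` diffeomorphism of `[0,1]`: it is `C^r` on
`[0,1]` (one-sided at the endpoints), increasing, and has a `C^r` inverse on `[0,1]`.
The values of `f` outside `[0,1]` play no role. -/
structure IsDiffPlus (r : WithTop ℕ∞) (f : ℝ → ℝ) : Prop where
  contDiffOn : ContDiffOn ℝ r f (Icc 0 1)
  mapsTo : MapsTo f (Icc 0 1) (Icc 0 1)
  strictMonoOn : StrictMonoOn f (Icc 0 1)
  exists_inverse : ∃ g : ℝ → ℝ, ContDiffOn ℝ r g (Icc 0 1) ∧ MapsTo g (Icc 0 1) (Icc 0 1) ∧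
    InvOn g f (Icc 0 1) (Icc 0 1)

/-- `var (log Df)`: the total variation over `[0,1]` of the logarithm of the derivative of `f`,
the derivative being taken relative to `[0,1]`. -/
noncomputable def varLogDeriv (f : ℝ → ℝ) : ENNReal :=
  eVariationOn (fun x => Real.log (derivWithin f (Icc 0 1) x)) (Icc 0 1)

/-- The sequence `(1/n) var (log Df^n)`, where `f^n` is the `n`-th iterate. -/
noncomputable def distortionSeq (f : ℝ → ℝ) (n : ℕ) : ENNReal :=
  varLogDeriv (f^[n]) / (n : ENNReal)

/-- The asymptotic distortion `dist_∞ (f) = lim_n (1/n) var (log Df^n)`. -/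
noncomputable def asymptoticDistortion (f : ℝ → ℝ) : ENNReal :=
  limUnder atTop (distortionSeq f)

/-- `φ t x` is the flow on `[0,1]`, defined for all times, of the vector field `X` on `[0,1]`:
each `t ↦ φ t x` with `x ∈ [0,1]` is an integral curve of `X` in `[0,1]` starting at `x`. -/
structure IsFlowOf (X : ℝ → ℝ) (φ : ℝ → ℝ → ℝ) : Prop where
  mem : ∀ t : ℝ, ∀ x ∈ Icc (0 : ℝ) 1, φ t x ∈ Icc (0 : ℝ) 1
  zero : ∀ x ∈ Icc (0 : ℝ) 1, φ 0 x = x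
  hasDerivAt : ∀ x ∈ Icc (0 : ℝ) 1, ∀ t : ℝ, HasDerivAt (fun s => φ s x) (X (φ t x)) t

/-- `f` is the time-1 map, on `[0,1]`, of the flow of the vector field `X` on `[0,1]`. -/
def IsTimeOneMap (X f : ℝ → ℝ) : Prop :=
  ∃ φ : ℝ → ℝ → ℝ, IsFlowOf X φ ∧ ∀ x ∈ Icc (0 : ℝ) 1, f x = φ 1 x

/-- `X` is `C^1`-flat at `p ∈ [0,1]`: both `X` and its derivative (one-sided at the endpoints)
vanish at `p`. -/
def IsC1FlatAt (X : ℝ → ℝ) (p : ℝ) : Prop :=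
  X p = 0 ∧ derivWithin X (Icc 0 1) p = 0

end IntervalDiffeo

open IntervalDiffeo

namespace IntervalDiffeo

/-! ### Total variation -/

/-! By the chain rule `log Df^n` is a Birkhoff sum of `log Df`, and composing with a monotone map of
the interval does not increase variation. Hence `var (log Df^n)` is subadditive and finite, and
Fekete's lemma gives the limit.

If `f` is the time-one map of a flat field `X`, then `X ∘ f = Df · X`, so formally `log Df` is the
coboundary of `log |X|`, whose variation is infinite near the zeros of `X`. Truncating its
derivative `DX / X` where `DX` is small, which flatness allows, gives a transfer function `G` of
bounded variation; by dominated convergence the error has variation at most any prescribed `η`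
(`exists_coboundary_approx`). The sums of `G ∘ f - G` telescope, so the limit is at most `η`.

Conversely, let the limit vanish. Fixed points are then parabolic, and the candidate field is the
Szekeres limit `X = lim (f^(n+1) - f^n) / Df^n`. Off the fixed points bounded distortion gives `DX =
-X · S`, where `S` is the termwise derivative of the series of `log Df` along the forward orbit.
This controls `DX` by the distance to a fixed point towards which `x` moves, but says nothing of
those it leaves. There the hypothesis enters a second time: it forces `S` to equal the corresponding
sum for the inverse (`tsum_log_sub_eq_inv`, `orbitSum_eq_inv`). So `|DX(x)| ≤ C |x - p|` for every
fixed point `p`, and `X` is `C^1` and flat. Its flow commutes with `f`, and comparing the two close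
to the limit of a forward orbit identifies `f` with the time-one map. -/

theorem eVariationOn_le_of_edist_le {u v : ℝ → ℝ} {s : Set ℝ}
    (h : ∀ x ∈ s, ∀ y ∈ s, edist (u x) (u y) ≤ edist (v x) (v y)) :
    eVariationOn u s ≤ eVariationOn v s := by
  refine iSup_le fun p => le_trans (Finset.sum_le_sum fun i _ => ?_)
    (eVariationOn.sum_le (f := v) (n := p.1) p.2.2.1 p.2.2.2)
  exact h _ (p.2.2.2 _) _ (p.2.2.2 _)

theorem eVariationOn_add_le (u v : ℝ → ℝ) (s : Set ℝ) :
    eVariationOn (fun x => u x + v x) s ≤ eVariationOn u s + eVariationOn v s := by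
  refine iSup_le fun p => ?_
  refine le_trans (Finset.sum_le_sum fun i _ => edist_add_add_le _ _ _ _) ?_
  rw [Finset.sum_add_distrib]
  exact add_le_add (eVariationOn.sum_le p.2.2.1 p.2.2.2) (eVariationOn.sum_le p.2.2.1 p.2.2.2)

theorem eVariationOn_neg (u : ℝ → ℝ) (s : Set ℝ) :
    eVariationOn (fun x => -u x) s = eVariationOn u s := by
  apply le_antisymm <;> exact eVariationOn_le_of_edist_le fun x _ y _ => by rw [edist_neg_neg]

theorem eVariationOn_sub_le (u v : ℝ → ℝ) (s : Set ℝ) :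
    eVariationOn (fun x => u x - v x) s ≤ eVariationOn u s + eVariationOn v s := by
  simpa only [sub_eq_add_neg, eVariationOn_neg] using eVariationOn_add_le u (fun x => -v x) s

theorem eVariationOn_sum_le {ι : Type*} (t : Finset ι) (u : ι → ℝ → ℝ) (s : Set ℝ) :
    eVariationOn (fun x => ∑ i ∈ t, u i x) s ≤ ∑ i ∈ t, eVariationOn (u i) s := by
  classical
  induction t using Finset.induction_on with
  | empty =>
    simp only [Finset.sum_empty, nonpos_iff_eq_zero]
    exact eVariationOn.constant_on (by rintro _ ⟨_, _, rfl⟩ _ ⟨_, _, rfl⟩; rfl)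
  | insert i t hi ih =>
    simp only [Finset.sum_insert hi]
    exact (eVariationOn_add_le _ _ _).trans (by gcongr)

/-- The function `R` is monotone and dominates the increments of `u`, so its total increase
dominates the variation. -/
theorem eVariationOn_le_of_abs_sub_le {u R : ℝ → ℝ} {a b : ℝ} (hab : a ≤ b)
    (h : ∀ x ∈ Icc a b, ∀ y ∈ Icc a b, x ≤ y → |u y - u x| ≤ R y - R x) :
    eVariationOn u (Icc a b) ≤ ENNReal.ofReal (R b - R a) := by
  have hR : MonotoneOn R (Icc a b) := fun x hx y hy hxy => by
    linarith [h x hx y hy hxy, abs_nonneg (u y - u x)]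
  refine le_trans (eVariationOn_le_of_edist_le (v := R) fun x hx y hy => ?_)
    ((hR.eVariationOn_eq (left_mem_Icc.2 hab) (right_mem_Icc.2 hab)).le.trans_eq' ?_)
  · rw [edist_dist, edist_dist]
    apply ENNReal.ofReal_le_ofReal
    rw [Real.dist_eq, Real.dist_eq]
    rcases le_total x y with hxy | hxy
    · rw [abs_sub_comm, abs_sub_comm (R x)]
      exact (h x hx y hy hxy).trans (le_abs_self _)
    · exact (h y hy x hx hxy).trans (le_abs_self _)
  · rw [inter_self]

/-! ### Diffeomorphisms with their derivatives -/

/-- `f` is an increasing diffeomorphism of `[0,1]` with inverse `g` and derivative `d`, and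
`w` is the continuous derivative of `log d`. -/
structure DiffData (f g d w : ℝ → ℝ) : Prop where
  mapsTo : MapsTo f (Icc 0 1) (Icc 0 1)
  mapsTo_inv : MapsTo g (Icc 0 1) (Icc 0 1)
  left_inv : ∀ x ∈ Icc (0 : ℝ) 1, g (f x) = x
  right_inv : ∀ x ∈ Icc (0 : ℝ) 1, f (g x) = x
  strictMonoOn : StrictMonoOn f (Icc 0 1)
  pos : ∀ x ∈ Icc (0 : ℝ) 1, 0 < d x
  hasDeriv : ∀ x ∈ Icc (0 : ℝ) 1, HasDerivWithinAt f (d x) (Icc 0 1) x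
  diff_inv : DifferentiableOn ℝ g (Icc 0 1)
  hasDeriv_log : ∀ x ∈ Icc (0 : ℝ) 1,
    HasDerivWithinAt (fun y => Real.log (d y)) (w x) (Icc 0 1) x
  cont : ContinuousOn w (Icc 0 1)

theorem uniqueDiffWithinAt_unit {x : ℝ} (hx : x ∈ Icc (0 : ℝ) 1) :
    UniqueDiffWithinAt ℝ (Icc (0 : ℝ) 1) x := uniqueDiffOn_Icc zero_lt_one x hx

theorem IsDiffPlus.exists_diffData {f : ℝ → ℝ} (hf : IsDiffPlus 2 f) :
    ∃ g w, DiffData f g (derivWithin f (Icc 0 1)) w := by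
  obtain ⟨g, hg, hgm, hgl, hgr⟩ := hf.exists_inverse
  have hfd : DifferentiableOn ℝ f (Icc 0 1) := hf.contDiffOn.differentiableOn (by norm_num)
  have hgd : DifferentiableOn ℝ g (Icc 0 1) := hg.differentiableOn (by norm_num)
  have hd : ∀ x ∈ Icc (0 : ℝ) 1, HasDerivWithinAt f (derivWithin f (Icc 0 1) x) (Icc 0 1) x :=
    fun x hx => (hfd x hx).hasDerivWithinAt
  have hpos : ∀ x ∈ Icc (0 : ℝ) 1, 0 < derivWithin f (Icc 0 1) x := by
    intro x hx
    have h0 : 0 ≤ derivWithin f (Icc 0 1) x := hf.strictMonoOn.monotoneOn.derivWithin_nonneg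
    have h1 := (hgd _ (hf.mapsTo hx)).hasDerivWithinAt.comp x (hd x hx) hf.mapsTo
    have h2 : HasDerivWithinAt (g ∘ f) 1 (Icc 0 1) x :=
      (hasDerivWithinAt_id x _).congr (fun y hy => hgl hy) (hgl hx)
    have h3 := (uniqueDiffWithinAt_unit hx).eq_deriv _ h1 h2
    refine lt_of_le_of_ne h0 fun h => ?_
    rw [← h] at h3
    simp at h3
  have hC : ContDiffOn ℝ 1 (derivWithin f (Icc 0 1)) (Icc 0 1) :=
    hf.contDiffOn.derivWithin (uniqueDiffOn_Icc zero_lt_one) (by norm_num)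
  have hL : ContDiffOn ℝ 1 (fun x => Real.log (derivWithin f (Icc 0 1) x)) (Icc 0 1) :=
    hC.log fun x hx => (hpos x hx).ne'
  exact ⟨g, _, ⟨hf.mapsTo, hgm, fun x hx => hgl hx, fun x hx => hgr hx, hf.strictMonoOn, hpos, hd,
    hgd, fun x hx => ((hL.differentiableOn (by norm_num)) x hx).hasDerivWithinAt,
    hL.continuousOn_derivWithin (uniqueDiffOn_Icc zero_lt_one) (by norm_num)⟩⟩

namespace DiffData
variable {f g d w : ℝ → ℝ}

theorem map_zero (h : DiffData f g d w) : f 0 = 0 := by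
  have h0 : (0 : ℝ) ∈ Icc (0 : ℝ) 1 := by simp
  have h1 := h.strictMonoOn.monotoneOn h0 (h.mapsTo_inv h0) (h.mapsTo_inv h0).1
  rw [h.right_inv 0 h0] at h1
  exact le_antisymm h1 (h.mapsTo h0).1

theorem map_one (h : DiffData f g d w) : f 1 = 1 := by
  have h0 : (1 : ℝ) ∈ Icc (0 : ℝ) 1 := by simp
  have h1 := h.strictMonoOn.monotoneOn (h.mapsTo_inv h0) h0 (h.mapsTo_inv h0).2
  rw [h.right_inv 1 h0] at h1
  exact le_antisymm (h.mapsTo h0).2 h1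

theorem continuousOn (h : DiffData f g d w) : ContinuousOn f (Icc 0 1) :=
  fun x hx => (h.hasDeriv x hx).continuousWithinAt

theorem continuousOn_log (h : DiffData f g d w) :
    ContinuousOn (fun x => Real.log (d x)) (Icc 0 1) :=
  fun x hx => (h.hasDeriv_log x hx).continuousWithinAt

theorem hasDeriv_d (h : DiffData f g d w) {x : ℝ} (hx : x ∈ Icc (0 : ℝ) 1) :
    HasDerivWithinAt d (w x * d x) (Icc 0 1) x := by
  have h1 := (h.hasDeriv_log x hx).exp
  rw [Real.exp_log (h.pos x hx), mul_comm] at h1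
  exact h1.congr (fun y hy => (Real.exp_log (h.pos y hy)).symm) (Real.exp_log (h.pos x hx)).symm

theorem continuousOn_d (h : DiffData f g d w) : ContinuousOn d (Icc 0 1) :=
  fun _ hx => (h.hasDeriv_d hx).continuousWithinAt

theorem hasDeriv_inv (h : DiffData f g d w) {x : ℝ} (hx : x ∈ Icc (0 : ℝ) 1) :
    HasDerivWithinAt g (d (g x))⁻¹ (Icc 0 1) x := by
  have hg := (h.diff_inv x hx).hasDerivWithinAt
  have h1 := (h.hasDeriv _ (h.mapsTo_inv hx)).comp x hg h.mapsTo_inv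
  have h2 : HasDerivWithinAt (f ∘ g) 1 (Icc 0 1) x :=
    (hasDerivWithinAt_id x _).congr (fun y hy => h.right_inv y hy) (h.right_inv x hx)
  have h3 := (uniqueDiffWithinAt_unit hx).eq_deriv _ h1 h2
  rwa [eq_inv_of_mul_eq_one_right h3] at hg

/-- This symmetry turns every forward-orbit estimate into a backward one. -/
theorem symm (h : DiffData f g d w) :
    DiffData g f (fun x => (d (g x))⁻¹) (fun x => -(w (g x) * (d (g x))⁻¹)) where
  mapsTo := h.mapsTo_inv
  mapsTo_inv := h.mapsTo
  left_inv := h.right_inv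
  right_inv := h.left_inv
  strictMonoOn x hx y hy hxy := by
    by_contra! hc
    have := h.strictMonoOn.monotoneOn (h.mapsTo_inv hy) (h.mapsTo_inv hx) hc
    rw [h.right_inv x hx, h.right_inv y hy] at this
    linarith
  pos x hx := inv_pos.2 (h.pos _ (h.mapsTo_inv hx))
  hasDeriv x hx := h.hasDeriv_inv hx
  diff_inv x hx := (h.hasDeriv x hx).differentiableWithinAt
  hasDeriv_log x hx := by
    simp only [Real.log_inv]
    exact ((h.hasDeriv_log _ (h.mapsTo_inv hx)).comp x (h.hasDeriv_inv hx) h.mapsTo_inv).neg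
  cont := by
    have hg : ContinuousOn g (Icc 0 1) := h.diff_inv.continuousOn
    exact ((h.cont.comp hg h.mapsTo_inv).mul ((h.continuousOn_d.comp hg h.mapsTo_inv).inv₀
      fun _ hx => (h.pos _ (h.mapsTo_inv hx)).ne')).neg

theorem iterate_mem (h : DiffData f g d w) (n : ℕ) {x : ℝ} (hx : x ∈ Icc (0 : ℝ) 1) :
    f^[n] x ∈ Icc (0 : ℝ) 1 := h.mapsTo.iterate n hx

theorem strictMonoOn_iterate (h : DiffData f g d w) (n : ℕ) :
    StrictMonoOn f^[n] (Icc 0 1) := by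
  induction n with
  | zero => exact fun x _ y _ hxy => hxy
  | succ n ih =>
    intro x hx y hy hxy
    rw [Function.iterate_succ_apply', Function.iterate_succ_apply']
    exact h.strictMonoOn (h.iterate_mem n hx) (h.iterate_mem n hy) (ih hx hy hxy)

/-- The uniform bound for `D log Df`. -/
theorem exists_bound (h : DiffData f g d w) :
    ∃ M : ℝ, 0 ≤ M ∧ ∀ x ∈ Icc (0 : ℝ) 1, |w x| ≤ M := by
  obtain ⟨M, hM⟩ := isCompact_Icc.exists_bound_of_continuousOn h.cont
  exact ⟨M, (norm_nonneg _).trans (hM 0 (by simp)), hM⟩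

theorem abs_log_sub_le (h : DiffData f g d w) {M : ℝ} (hM : ∀ x ∈ Icc (0 : ℝ) 1, |w x| ≤ M)
    {x y : ℝ} (hx : x ∈ Icc (0 : ℝ) 1) (hy : y ∈ Icc (0 : ℝ) 1) :
    |Real.log (d y) - Real.log (d x)| ≤ M * |y - x| :=
  (convex_Icc (0 : ℝ) 1).norm_image_sub_le_of_norm_hasDerivWithin_le h.hasDeriv_log hM hx hy

end DiffData

/-- `log Df^n` as a Birkhoff sum of `log d`, where `d` is the derivative of `f`. -/
noncomputable def logIter (f d : ℝ → ℝ) (n : ℕ) (x : ℝ) : ℝ :=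
  ∑ k ∈ Finset.range n, Real.log (d (f^[k] x))

theorem logIter_add (f d : ℝ → ℝ) (m n : ℕ) (x : ℝ) :
    logIter f d (m + n) x = logIter f d m x + logIter f d n (f^[m] x) := by
  simp only [logIter, Finset.sum_range_add]
  congr 1
  refine Finset.sum_congr rfl fun k _ => ?_
  rw [add_comm m k, Function.iterate_add_apply]

theorem logIter_succ (f d : ℝ → ℝ) (n : ℕ) (x : ℝ) :
    logIter f d (n + 1) x = logIter f d n x + Real.log (d (f^[n] x)) := by
  simp only [logIter, Finset.sum_range_succ]

/-! ### Chain rule for iterates and subadditivity of the distortion. -/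

namespace DiffData
variable {f g d w : ℝ → ℝ}

theorem hasDeriv_iterate (h : DiffData f g d w) (n : ℕ) {x : ℝ} (hx : x ∈ Icc (0 : ℝ) 1) :
    HasDerivWithinAt f^[n] (Real.exp (logIter f d n x)) (Icc 0 1) x := by
  induction n with
  | zero => simpa [logIter] using hasDerivWithinAt_id x _
  | succ n ih =>
    rw [logIter_succ, Real.exp_add, Real.exp_log (h.pos _ (h.iterate_mem n hx)), mul_comm,
      Function.iterate_succ']
    exact (h.hasDeriv _ (h.iterate_mem n hx)).comp x ih (h.mapsTo.iterate n)

theorem varLogDeriv_iterate (h : DiffData f g d w) (n : ℕ) :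
    varLogDeriv f^[n] = eVariationOn (logIter f d n) (Icc 0 1) := by
  refine eVariationOn.congr fun x hx => ?_
  rw [(h.hasDeriv_iterate n hx).derivWithin (uniqueDiffWithinAt_unit hx), Real.log_exp]

/-- The cocycle relation splits the logarithm into two terms, the second precomposed with the
monotone `f^[m]`, which cannot increase variation. -/
theorem varLogDeriv_iterate_add_le (h : DiffData f g d w) (m n : ℕ) :
    varLogDeriv f^[m + n] ≤ varLogDeriv f^[m] + varLogDeriv f^[n] := by
  rw [h.varLogDeriv_iterate, h.varLogDeriv_iterate, h.varLogDeriv_iterate]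
  have h1 : eVariationOn (logIter f d (m + n)) (Icc 0 1) =
      eVariationOn (fun x => logIter f d m x + (logIter f d n ∘ f^[m]) x) (Icc 0 1) :=
    eVariationOn.congr fun x _ => logIter_add f d m n x
  rw [h1]
  refine (eVariationOn_add_le _ _ _).trans (add_le_add le_rfl ?_)
  exact eVariationOn.comp_le_of_monotoneOn _ _ (h.strictMonoOn_iterate m).monotoneOn
    (h.mapsTo.iterate m)

theorem varLogDeriv_iterate_ne_top (h : DiffData f g d w) (n : ℕ) :
    varLogDeriv f^[n] ≠ ⊤ := by
  obtain ⟨M, -, hM⟩ := h.exists_bound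
  have h1 : varLogDeriv f^[1] ≠ ⊤ := by
    rw [h.varLogDeriv_iterate]
    refine ne_top_of_le_ne_top ENNReal.ofReal_ne_top
      (eVariationOn_le_of_abs_sub_le (R := fun x => M * x) zero_le_one fun x hx y hy hxy => ?_)
    have := h.abs_log_sub_le hM hx hy
    rw [abs_of_nonneg (sub_nonneg.2 hxy)] at this
    simp only [logIter, Finset.sum_range_one, Function.iterate_zero_apply]
    linarith
  induction n with
  | zero =>
    rw [h.varLogDeriv_iterate, eVariationOn.constant_on]
    · exact ENNReal.zero_ne_top
    · rintro _ ⟨_, _, rfl⟩ _ ⟨_, _, rfl⟩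
      simp [logIter]
  | succ n ih =>
    exact ne_top_of_le_ne_top (ENNReal.add_ne_top.2 ⟨ih, h1⟩) (h.varLogDeriv_iterate_add_le n 1)

/-- The limit defining the asymptotic distortion exists and is finite. -/
theorem exists_tendsto_distortionSeq (h : DiffData f g d w) :
    ∃ L : ℝ, 0 ≤ L ∧
      Tendsto (fun n : ℕ => (varLogDeriv f^[n]).toReal / n) atTop (𝓝 L) ∧
      Tendsto (distortionSeq f) atTop (𝓝 (ENNReal.ofReal L)) := by
  have hs : Subadditive fun n : ℕ => (varLogDeriv f^[n]).toReal := fun m n => by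
    rw [← ENNReal.toReal_add (h.varLogDeriv_iterate_ne_top m) (h.varLogDeriv_iterate_ne_top n)]
    exact ENNReal.toReal_mono (ENNReal.add_ne_top.2 ⟨h.varLogDeriv_iterate_ne_top m,
      h.varLogDeriv_iterate_ne_top n⟩) (h.varLogDeriv_iterate_add_le m n)
  -- Fekete's lemma; nonnegativity supplies the required lower bound.
  have ht := hs.tendsto_lim ⟨0, by rintro _ ⟨n, rfl⟩; positivity⟩
  refine ⟨hs.lim, ge_of_tendsto' ht fun n => by positivity, ht, ?_⟩
  refine ((ENNReal.continuous_ofReal.tendsto _).comp ht).congr' ?_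
  filter_upwards [eventually_gt_atTop 0] with n hn
  simp only [Function.comp_apply, distortionSeq]
  rw [ENNReal.ofReal_div_of_pos (by exact_mod_cast hn),
    ENNReal.ofReal_toReal (h.varLogDeriv_iterate_ne_top n), ENNReal.ofReal_natCast]

end DiffData
/-! ### Primitives on the unit interval -/

theorem exists_primitive {γ : ℝ → ℝ} (hγ : ContinuousOn γ (Icc 0 1)) :
    ∃ G : ℝ → ℝ, (∀ x ∈ Icc (0 : ℝ) 1, HasDerivWithinAt G (γ x) (Icc 0 1) x) ∧
      G 1 - G 0 = ∫ x in (0 : ℝ)..1, γ x := by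
  have hc : Continuous (IccExtend (zero_le_one (α := ℝ)) (domRestrict (Icc 0 1) γ)) :=
    (continuousOn_iff_continuous_domRestrict.1 hγ).Icc_extend'
  have he : ∀ x ∈ Icc (0 : ℝ) 1, IccExtend (zero_le_one (α := ℝ)) (domRestrict (Icc 0 1) γ) x = γ x :=
    fun x hx => IccExtend_of_mem _ _ hx
  refine ⟨fun x => ∫ t in (0 : ℝ)..x, IccExtend (zero_le_one (α := ℝ)) (domRestrict (Icc 0 1) γ) t,
    fun x hx => ?_, ?_⟩
  · rw [← he x hx]
    exact (hc.integral_hasStrictDerivAt 0 x).hasDerivAt.hasDerivWithinAt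
  · simp only [intervalIntegral.integral_same, sub_zero]
    refine intervalIntegral.integral_congr fun x hx => he x ?_
    rwa [uIcc_of_le zero_le_one] at hx

/-- If `R` is a primitive of `|u'|`, then `R - u` and `R + u` are both monotone. -/
theorem eVariationOn_le_integral_abs {u u' : ℝ → ℝ}
    (hu : ∀ x ∈ Icc (0 : ℝ) 1, HasDerivWithinAt u (u' x) (Icc 0 1) x)
    (hc : ContinuousOn u' (Icc 0 1)) :
    eVariationOn u (Icc 0 1) ≤ ENNReal.ofReal (∫ x in (0 : ℝ)..1, |u' x|) := by
  obtain ⟨R, hR, hR1⟩ := exists_primitive hc.abs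
  rw [← hR1]
  have key : ∀ v v' : ℝ → ℝ, (∀ x ∈ Icc (0 : ℝ) 1, HasDerivWithinAt v (v' x) (Icc 0 1) x) →
      (∀ x ∈ Icc (0 : ℝ) 1, 0 ≤ v' x) → MonotoneOn v (Icc 0 1) := fun v v' hv hv' =>
    monotoneOn_of_hasDerivWithinAt_nonneg (convex_Icc 0 1)
      (fun x hx => (hv x hx).continuousWithinAt)
      (fun x hx => (hv x (interior_subset hx)).mono interior_subset)
      fun x hx => hv' x (interior_subset hx)
  have h1 := key _ _ (fun x hx => (hR x hx).sub (hu x hx))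
    fun x _ => sub_nonneg.2 (le_abs_self _)
  have h2 := key _ _ (fun x hx => (hR x hx).add (hu x hx))
    fun x _ => by linarith [neg_abs_le (u' x)]
  refine eVariationOn_le_of_abs_sub_le zero_le_one fun x hx y hy hxy => abs_le.2 ⟨?_, ?_⟩
  · have := h2 hx hy hxy
    simp only [Pi.add_apply] at this
    linarith
  · have := h1 hx hy hxy
    simp only [Pi.sub_apply] at this
    linarith

/-! ### Isolated points -/

/-- The isolated points form a discrete subspace of a second countable space. -/
theorem countable_not_accPt (s : Set ℝ) : {x ∈ s | ¬ AccPt x (𝓟 s)}.Countable := by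
  set t := {x ∈ s | ¬ AccPt x (𝓟 s)}
  have : DiscreteTopology t := by
    rw [discreteTopology_subtype_iff]
    intro x hx
    have h1 : 𝓝[≠] x ⊓ 𝓟 s = ⊥ := by
      by_contra hc
      exact hx.2 ⟨hc⟩
    exact le_bot_iff.1 (h1 ▸ inf_le_inf_left _ (principal_mono.2 fun y hy => hy.1))
  exact (countable_coe_iff).1 (TopologicalSpace.separableSpace_iff_countable.1 inferInstance)

/-- If `f` has a fixed point set containing `s`, then the derivative of `log Df` vanishes at almost
every point of `s`. -/
theorem DiffData.ae_eq_zero_of_fixed {f g d w : ℝ → ℝ} (h : DiffData f g d w) {s : Set ℝ}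
    (hs : s ⊆ Icc 0 1) (hfix : ∀ x ∈ s, f x = x) :
    ∀ᵐ x, x ∈ s → w x = 0 := by
  have hacc : ∀ (u : ℝ → ℝ) (u' c : ℝ) (t : Set ℝ) (x : ℝ), t ⊆ Icc 0 1 → x ∈ Icc (0 : ℝ) 1 →
      AccPt x (𝓟 t) → (∀ y ∈ t, u y = c) → HasDerivWithinAt u u' (Icc 0 1) x → u' = 0 := by
    intro u u' c t x ht hx hxt hu hd
    by_contra hne
    have h1 := hd.eventually_ne (c := c) hne
    rw [accPt_iff_frequently] at hxt
    rw [eventually_nhdsWithin_iff] at h1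
    obtain ⟨y, ⟨hy1, hy2⟩, hy3⟩ := (hxt.and_eventually h1).exists
    exact hy3 ⟨ht hy2, hy1⟩ (hu y hy2)
  -- A function constant on a set has zero derivative at its accumulation points. Used twice: `f -
  -- id` on `s` gives `log d = 0` on `t`, and `log d` on `t` then gives `w = 0`. Each use loses only
  -- countably many points.
  set t := {x ∈ s | AccPt x (𝓟 s)} with htdef
  have hts : t ⊆ Icc 0 1 := fun x hx => hs hx.1
  have ht : ∀ x ∈ t, Real.log (d x) = 0 := by
    intro x hx
    have h1 := hacc _ _ 0 s x hs (hs hx.1) hx.2 (fun y hy => by simp [hfix y hy])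
      ((h.hasDeriv x (hs hx.1)).sub (hasDerivWithinAt_id x _))
    rw [sub_eq_zero.1 h1, Real.log_one]
  have hcount : ({x ∈ s | ¬ AccPt x (𝓟 s)} ∪ {x ∈ t | ¬ AccPt x (𝓟 t)}).Countable :=
    (countable_not_accPt s).union (countable_not_accPt t)
  filter_upwards [hcount.ae_notMem MeasureTheory.volume] with x hx hxs
  have hxt : x ∈ t := by
    by_contra hc
    exact hx (Or.inl ⟨hxs, fun ha => hc ⟨hxs, ha⟩⟩)
  have hxa : AccPt x (𝓟 t) := by
    by_contra hc
    exact hx (Or.inr ⟨hxt, hc⟩)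
  exact hacc _ _ 0 t x hts (hs hxs) hxa ht (h.hasDeriv_log x (hs hxs))

/-! ### Flows -/

theorem integralCurve_unique {X α β : ℝ → ℝ} {s : Set ℝ} {K : NNReal} (hX : LipschitzOnWith K X s)
    (hα : ∀ t, HasDerivAt α (X (α t)) t) (hαs : ∀ t, α t ∈ s)
    (hβ : ∀ t, HasDerivAt β (X (β t)) t) (hβs : ∀ t, β t ∈ s) {t₀ : ℝ} (h : α t₀ = β t₀) : α = β :=
  ODE_solution_unique_univ (v := fun _ => X) (s := fun _ => s) (fun _ => hX)
    (fun t => ⟨hα t, hαs t⟩) (fun t => ⟨hβ t, hβs t⟩) h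

theorem IsFlowOf.flow_eq_self {X : ℝ → ℝ} {φ : ℝ → ℝ → ℝ} (hφ : IsFlowOf X φ) {K : NNReal}
    (hX : LipschitzOnWith K X (Icc 0 1)) {x : ℝ} (hx : x ∈ Icc (0 : ℝ) 1) (h0 : X x = 0) (t : ℝ) :
    φ t x = x := by
  have := integralCurve_unique hX (hφ.hasDerivAt x hx) (fun t => hφ.mem t x hx)
    (β := fun _ => x) (fun t => by simpa [h0] using hasDerivAt_const t x) (fun _ => hx)
    (hφ.zero x hx)
  exact congrFun this t

theorem IsFlowOf.flow_add {X : ℝ → ℝ} {φ : ℝ → ℝ → ℝ} (hφ : IsFlowOf X φ) {K : NNReal}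
    (hX : LipschitzOnWith K X (Icc 0 1)) {x : ℝ} (hx : x ∈ Icc (0 : ℝ) 1) (s t : ℝ) :
    φ s (φ t x) = φ (s + t) x := by
  have := integralCurve_unique hX (hφ.hasDerivAt _ (hφ.mem t x hx))
    (fun s => hφ.mem s _ (hφ.mem t x hx)) (β := fun s => φ (s + t) x)
    (fun s => (hφ.hasDerivAt x hx (s + t)).comp_add_const s t)
    (fun s => hφ.mem _ x hx) (t₀ := 0) (by simp [hφ.zero _ (hφ.mem t x hx)])
  exact congrFun this s

theorem lipschitzOnWith_of_contDiffOn {X : ℝ → ℝ} (hX : ContDiffOn ℝ 1 X (Icc 0 1)) :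
    ∃ K : NNReal, LipschitzOnWith K X (Icc 0 1) :=
  hX.exists_lipschitzOnWith one_ne_zero (convex_Icc 0 1) isCompact_Icc

namespace DiffData
variable {f g d w : ℝ → ℝ}

/-- A diffeomorphism preserves any vector field of which it is the time-one map. -/
theorem map_vectorField (h : DiffData f g d w) {X : ℝ → ℝ} {φ : ℝ → ℝ → ℝ} (hφ : IsFlowOf X φ)
    (hf : ∀ x ∈ Icc (0 : ℝ) 1, f x = φ 1 x) {K : NNReal} (hX : LipschitzOnWith K X (Icc 0 1))
    {x : ℝ} (hx : x ∈ Icc (0 : ℝ) 1) : X (f x) = d x * X x := by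
  have h1 := hφ.hasDerivAt x hx 0
  have h2 : HasDerivAt (fun s => φ s (f x)) (X (f x)) 0 := by
    simpa [hφ.zero _ (h.mapsTo hx)] using hφ.hasDerivAt _ (h.mapsTo hx) 0
  have h3 : HasDerivAt (fun s => f (φ s x)) (d x * X x) 0 := by
    have h4 : HasDerivWithinAt f (d x) (Icc 0 1) (φ 0 x) := by
      rw [hφ.zero x hx]; exact h.hasDeriv x hx
    have := h4.comp_hasDerivAt 0 h1 (Eventually.of_forall fun s => hφ.mem s x hx)
    rwa [hφ.zero x hx] at this
  have h5 : (fun s => φ s (f x)) = fun s => f (φ s x) := by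
    funext s
    rw [hf x hx, hf _ (hφ.mem s x hx), hφ.flow_add hX hx, hφ.flow_add hX hx, add_comm]
  rw [h5] at h2
  exact h2.unique h3

end DiffData
/-! ### Time-one maps of flat vector fields are undistorted -/

/-- Truncation of a real number to `[-ε, ε]`. -/
noncomputable def clip (ε u : ℝ) : ℝ := max (-ε) (min ε u)

theorem continuous_clip (ε : ℝ) : Continuous (clip ε) :=
  continuous_const.max (continuous_const.min continuous_id)

theorem abs_clip_le {ε : ℝ} (hε : 0 ≤ ε) (u : ℝ) : |clip ε u| ≤ ε :=
  abs_le.2 ⟨le_max_left _ _, max_le (by linarith) (min_le_left _ _)⟩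

theorem clip_of_abs_le {ε u : ℝ} (hu : |u| ≤ ε) : clip ε u = u := by
  rw [clip, min_eq_right (abs_le.1 hu).2, max_eq_right (abs_le.1 hu).1]

theorem abs_clip_sub_clip_le (ε u v : ℝ) : |clip ε u - clip ε v| ≤ |u - v| := by
  unfold clip
  refine (abs_max_sub_max_le_max _ _ _ _).trans (max_le (by simp) ?_)
  exact (abs_min_sub_min_le_max _ _ _ _).trans (max_le (by simp) le_rfl)

namespace DiffData
variable {f g d w : ℝ → ℝ}

/-- If `X` is `f`-invariant then `X · D log Df = DX ∘ f - DX`. -/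
theorem mul_eq_of_invariant (h : DiffData f g d w) {X Y : ℝ → ℝ}
    (hX : ∀ x ∈ Icc (0 : ℝ) 1, HasDerivWithinAt X (Y x) (Icc 0 1) x)
    (hinv : ∀ x ∈ Icc (0 : ℝ) 1, X (f x) = d x * X x) {x : ℝ} (hx : x ∈ Icc (0 : ℝ) 1) :
    w x * X x = Y (f x) - Y x := by
  have h1 := (hX _ (h.mapsTo hx)).comp x (h.hasDeriv x hx) h.mapsTo
  have h2 : HasDerivWithinAt (X ∘ f) _ (Icc 0 1) x :=
    ((h.hasDeriv_d hx).mul (hX x hx)).congr (fun y hy => hinv y hy) (hinv x hx)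
  have h3 := (uniqueDiffWithinAt_unit hx).eq_deriv _ h1 h2
  have := h.pos x hx
  apply mul_left_cancel₀ this.ne'
  linarith

/-- If `f` preserves the flat vector field `X`, then `log Df` is a coboundary up to a function
of small total variation. -/
theorem exists_coboundary_approx (h : DiffData f g d w) {X Y : ℝ → ℝ}
    (hX : ∀ x ∈ Icc (0 : ℝ) 1, HasDerivWithinAt X (Y x) (Icc 0 1) x)
    (hY : ContinuousOn Y (Icc 0 1))
    (hinv : ∀ x ∈ Icc (0 : ℝ) 1, X (f x) = d x * X x)
    (hfix : ∀ x ∈ Icc (0 : ℝ) 1, X x = 0 → f x = x)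
    (hflat : ∀ x ∈ Icc (0 : ℝ) 1, X x = 0 → Y x = 0) {η : ℝ} (hη : 0 < η) :
    ∃ G : ℝ → ℝ, eVariationOn G (Icc 0 1) ≠ ⊤ ∧
      eVariationOn (fun x => Real.log (d x) - (G (f x) - G x)) (Icc 0 1) ≤ ENNReal.ofReal η := by
  -- This is the derivative `Y / X` of `log |X|`, with the values of `Y` in `[-ε, ε]` cut out. By
  -- flatness it vanishes near every zero of `X`, hence it is continuous.
  set γ : ℝ → ℝ → ℝ := fun ε x => (Y x - clip ε (Y x)) / X x with hγdef
  have hXc : ContinuousOn X (Icc 0 1) := fun x hx => (hX x hx).continuousWithinAt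
  have hγ : ∀ ε > 0, ContinuousOn (γ ε) (Icc 0 1) := by
    intro ε hε x hx
    by_cases h0 : X x = 0
    · have hev : ∀ᶠ y in 𝓝[Icc 0 1] x, |Y y| < ε := by
        have := (hY x hx).abs
        refine this.eventually_lt continuousWithinAt_const ?_
        simpa [hflat x hx h0] using hε
      refine (continuousWithinAt_const (b := (0 : ℝ))).congr_of_eventuallyEq ?_ ?_
      · filter_upwards [hev] with y hy
        simp [hγdef, clip_of_abs_le hy.le]
      · simp [hγdef, h0]
    · exact ((hY x hx).sub ((continuous_clip ε).continuousAt.comp_continuousWithinAt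
        (hY x hx))).div (hXc x hx) h0
  set ρ : ℝ → ℝ → ℝ := fun ε x => w x - (γ ε (f x) * d x - γ ε x) with hρdef
  have hρc : ∀ ε > 0, ContinuousOn (ρ ε) (Icc 0 1) := fun ε hε =>
    h.cont.sub ((((hγ ε hε).comp h.continuousOn h.mapsTo).mul h.continuousOn_d).sub (hγ ε hε))
  have hρ0 : ∀ ε, ∀ x ∈ Icc (0 : ℝ) 1, X x = 0 → ρ ε x = w x := by
    intro ε x hx h0
    simp [hρdef, hγdef, hfix x hx h0, h0]
  have hρ1 : ∀ ε, ∀ x ∈ Icc (0 : ℝ) 1, X x ≠ 0 →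
      ρ ε x = (clip ε (Y (f x)) - clip ε (Y x)) / X x := by
    intro ε x hx h0
    have hd := (h.pos x hx).ne'
    have hw := h.mul_eq_of_invariant hX hinv hx
    simp only [hρdef, hγdef, hinv x hx]
    field_simp
    linarith
  -- Truncation is 1-Lipschitz, so the error is dominated by `|w|` uniformly in `ε`.
  have hbound : ∀ ε, ∀ x ∈ Icc (0 : ℝ) 1, |ρ ε x| ≤ |w x| := by
    intro ε x hx
    by_cases h0 : X x = 0
    · rw [hρ0 ε x hx h0]
    · rw [hρ1 ε x hx h0, abs_div, div_le_iff₀ (abs_pos.2 h0), ← abs_mul,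
        h.mul_eq_of_invariant hX hinv hx]
      exact abs_clip_sub_clip_le _ _ _
  have hsub : ∀ {x : ℝ}, x ∈ uIoc (0 : ℝ) 1 → x ∈ Icc (0 : ℝ) 1 := by
    intro x hx
    rw [uIoc_of_le zero_le_one] at hx
    exact Ioc_subset_Icc_self hx
  have hlim : Tendsto (fun ε => ∫ x in (0 : ℝ)..1, |ρ ε x|) (𝓝[>] 0)
      (𝓝 (∫ _ in (0 : ℝ)..1, (0 : ℝ))) := by
    refine intervalIntegral.tendsto_integral_filter_of_dominated_convergence (fun x => |w x|)
      ?_ ?_ ?_ ?_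
    · filter_upwards [self_mem_nhdsWithin] with ε hε
      rw [uIoc_of_le zero_le_one]
      exact ((hρc ε hε).abs.mono Ioc_subset_Icc_self).aestronglyMeasurable measurableSet_Ioc
    · refine Eventually.of_forall fun ε => Eventually.of_forall fun x hx => ?_
      simpa using hbound ε x (hsub hx)
    · apply ContinuousOn.intervalIntegrable
      rw [uIcc_of_le zero_le_one]
      exact h.cont.abs
    -- Where `X` vanishes the error is `w`, which is zero almost everywhere there because these
    -- points are fixed; elsewhere it is at most `2ε / |X x|`.
    · filter_upwards [h.ae_eq_zero_of_fixed (s := {x ∈ Icc (0 : ℝ) 1 | X x = 0})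
        (fun x hx => hx.1) fun x hx => hfix x hx.1 hx.2] with x hx hxI
      have hxI := hsub hxI
      by_cases h0 : X x = 0
      · simp [hρ0 _ x hxI h0, hx ⟨hxI, h0⟩]
      · have hε : Tendsto (fun ε : ℝ => 2 * ε / |X x|) (𝓝[>] 0) (𝓝 0) := by
          have : Continuous fun ε : ℝ => 2 * ε / |X x| := by fun_prop
          simpa using (this.tendsto 0).mono_left nhdsWithin_le_nhds
        refine squeeze_zero' (Eventually.of_forall fun ε => abs_nonneg _) ?_ hε
        filter_upwards [self_mem_nhdsWithin] with ε hε
        rw [hρ1 ε x hxI h0, abs_div]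
        gcongr
        refine (abs_sub _ _).trans ?_
        linarith [abs_clip_le (le_of_lt hε) (Y (f x)), abs_clip_le (le_of_lt hε) (Y x)]
  rw [intervalIntegral.integral_zero] at hlim
  obtain ⟨ε, hε1, hε⟩ := ((hlim.eventually (gt_mem_nhds hη)).and self_mem_nhdsWithin).exists
  obtain ⟨G, hG, -⟩ := exists_primitive (hγ ε hε)
  refine ⟨G, ne_top_of_le_ne_top ENNReal.ofReal_ne_top
    (eVariationOn_le_integral_abs hG (hγ ε hε)), ?_⟩
  refine (eVariationOn_le_integral_abs (u' := ρ ε) (fun x hx => ?_) (hρc ε hε)).trans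
    (ENNReal.ofReal_le_ofReal hε1.le)
  exact (h.hasDeriv_log x hx).sub (((hG _ (h.mapsTo hx)).comp x (h.hasDeriv x hx) h.mapsTo).sub
    (hG x hx))

/-- The coboundary part of the Birkhoff sum telescopes to `G ∘ f^[n] - G`; each remainder term is
precomposed with a monotone iterate. -/
theorem varLogDeriv_iterate_le_of_coboundary (h : DiffData f g d w) (G : ℝ → ℝ) (n : ℕ) :
    varLogDeriv f^[n] ≤ 2 * eVariationOn G (Icc 0 1) +
      n * eVariationOn (fun x => Real.log (d x) - (G (f x) - G x)) (Icc 0 1) := by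
  rw [h.varLogDeriv_iterate]
  set r : ℝ → ℝ := fun x => Real.log (d x) - (G (f x) - G x)
  have h1 : ∀ x, logIter f d n x =
      ((G ∘ f^[n]) x - G x) + ∑ k ∈ Finset.range n, (r ∘ f^[k]) x := by
    intro x
    induction n with
    | zero => simp [logIter]
    | succ n ih =>
      rw [logIter_succ, Finset.sum_range_succ, ih]
      simp only [Function.comp_apply, r, Function.iterate_succ_apply']
      ring
  rw [funext h1]
  have hcomp : ∀ (u : ℝ → ℝ) (k : ℕ),
      eVariationOn (u ∘ f^[k]) (Icc 0 1) ≤ eVariationOn u (Icc 0 1) := fun u k =>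
    eVariationOn.comp_le_of_monotoneOn _ _ (h.strictMonoOn_iterate k).monotoneOn
      (h.mapsTo.iterate k)
  refine (eVariationOn_add_le _ _ _).trans (add_le_add ?_ ?_)
  · rw [two_mul]
    exact (eVariationOn_sub_le _ _ _).trans (add_le_add (hcomp G n) le_rfl)
  · refine (eVariationOn_sum_le _ _ _).trans ?_
    refine (Finset.sum_le_sum fun k _ => hcomp r k).trans ?_
    simp

theorem tendsto_zero_of_timeOneMap (h : DiffData f g d w) {X : ℝ → ℝ}
    (hX : ContDiffOn ℝ 1 X (Icc 0 1)) (hf : IsTimeOneMap X f)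
    (hflat : ∀ p ∈ Icc (0 : ℝ) 1, X p = 0 → IsC1FlatAt X p) {L : ℝ} (hL0 : 0 ≤ L)
    (hL : Tendsto (fun n : ℕ => (varLogDeriv f^[n]).toReal / n) atTop (𝓝 L)) : L = 0 := by
  obtain ⟨φ, hφ, hfφ⟩ := hf
  obtain ⟨K, hK⟩ := lipschitzOnWith_of_contDiffOn hX
  refine le_antisymm (le_of_forall_pos_le_add fun η hη => ?_) hL0
  obtain ⟨G, hG, hr⟩ := h.exists_coboundary_approx
    (fun x hx => ((hX.differentiableOn one_ne_zero) x hx).hasDerivWithinAt)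
    (hX.continuousOn_derivWithin (uniqueDiffOn_Icc zero_lt_one) le_rfl)
    (fun x hx => h.map_vectorField hφ hfφ hK hx)
    (fun x hx h0 => by rw [hfφ x hx, hφ.flow_eq_self hK hx h0]) (fun x hx h0 => (hflat x hx h0).2) hη
  have hlim : Tendsto (fun n : ℕ => 2 * (eVariationOn G (Icc 0 1)).toReal / n + η) atTop
      (𝓝 (0 + η)) := (tendsto_const_div_atTop_nhds_zero_nat _).add_const η
  refine le_of_tendsto_of_tendsto hL hlim ?_
  filter_upwards [eventually_gt_atTop 0] with n hn
  have hn' : (0 : ℝ) < n := by exact_mod_cast hn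
  rw [div_add' _ _ _ hn'.ne']
  gcongr
  have h1 : varLogDeriv f^[n] ≤ 2 * eVariationOn G (Icc 0 1) + n * ENNReal.ofReal η :=
    (h.varLogDeriv_iterate_le_of_coboundary G n).trans (by gcongr)
  have h2 : 2 * eVariationOn G (Icc 0 1) ≠ ⊤ := ENNReal.mul_ne_top (by simp) hG
  have h3 : n * ENNReal.ofReal η ≠ ⊤ := ENNReal.mul_ne_top (by simp) ENNReal.ofReal_ne_top
  have h4 := ENNReal.toReal_mono (ENNReal.add_ne_top.2 ⟨h2, h3⟩) h1
  rw [ENNReal.toReal_add h2 h3, ENNReal.toReal_mul, ENNReal.toReal_mul,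
    ENNReal.toReal_ofReal hη.le] at h4
  simp only [ENNReal.toReal_ofNat, ENNReal.toReal_natCast] at h4
  linarith

end DiffData
/-! ### Distortion estimates along orbits -/

theorem exists_mem_uIcc_sub_eq {u u' : ℝ → ℝ}
    (hu : ∀ x ∈ Icc (0 : ℝ) 1, HasDerivWithinAt u (u' x) (Icc 0 1) x) {a b : ℝ}
    (ha : a ∈ Icc (0 : ℝ) 1) (hb : b ∈ Icc (0 : ℝ) 1) :
    ∃ ξ ∈ uIcc a b, u b - u a = u' ξ * (b - a) := by
  have key : ∀ a ∈ Icc (0 : ℝ) 1, ∀ b ∈ Icc (0 : ℝ) 1, a < b →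
      ∃ ξ ∈ Icc a b, u b - u a = u' ξ * (b - a) := by
    intro a ha b hb hab
    obtain ⟨ξ, hξ, he⟩ := exists_hasDerivAt_eq_slope u u' hab
      (fun x hx => ((hu x ⟨ha.1.trans hx.1, hx.2.trans hb.2⟩).continuousWithinAt).mono
        (Icc_subset_Icc ha.1 hb.2))
      fun x hx => (hu x ⟨ha.1.trans hx.1.le, hx.2.le.trans hb.2⟩).hasDerivAt
        (Icc_mem_nhds (ha.1.trans_lt hx.1) (hx.2.trans_le hb.2))
    refine ⟨ξ, Ioo_subset_Icc_self hξ, ?_⟩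
    rw [he, div_mul_cancel₀ _ (sub_pos.2 hab).ne']
  rcases lt_trichotomy a b with hab | hab | hab
  · rw [uIcc_of_le hab.le]
    exact key a ha b hb hab
  · exact ⟨a, left_mem_uIcc, by simp [hab]⟩
  · rw [uIcc_of_ge hab.le]
    obtain ⟨ξ, h1, h2⟩ := key b hb a ha hab
    exact ⟨ξ, h1, by linarith⟩

theorem uIcc_subset_unit {a b : ℝ} (ha : a ∈ Icc (0 : ℝ) 1) (hb : b ∈ Icc (0 : ℝ) 1) :
    uIcc a b ⊆ Icc 0 1 := uIcc_subset_Icc ha hb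

/-- Two points are adjacent for `f` if one of them lies between the other and its image. -/
def Adjacent (f : ℝ → ℝ) (x z : ℝ) : Prop := z ∈ uIcc x (f x) ∨ x ∈ uIcc z (f z)

/-- The formal derivative of `z ↦ ∑ log Df (f^k z)`. -/
noncomputable def orbitSum (f d w : ℝ → ℝ) (x : ℝ) : ℝ :=
  ∑' k : ℕ, w (f^[k] x) * Real.exp (logIter f d k x)

namespace DiffData
variable {f g d w : ℝ → ℝ} {M : ℝ} {x z : ℝ}

theorem iterate_mem_uIcc (h : DiffData f g d w) (k : ℕ) {y : ℝ} (hx : x ∈ Icc (0 : ℝ) 1)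
    (hy : y ∈ Icc (0 : ℝ) 1) (hz : z ∈ uIcc x y) : f^[k] z ∈ uIcc (f^[k] x) (f^[k] y) := by
  have hzI := uIcc_subset_unit hx hy hz
  have hmono := (h.strictMonoOn_iterate k).monotoneOn
  rcases le_total x y with hxy | hxy
  · rw [uIcc_of_le hxy] at hz
    exact mem_uIcc.2 (Or.inl ⟨hmono hx hzI hz.1, hmono hzI hy hz.2⟩)
  · rw [uIcc_of_ge hxy] at hz
    exact mem_uIcc.2 (Or.inr ⟨hmono hy hzI hz.1, hmono hzI hx hz.2⟩)

/-- Orbits of an increasing map are monotone, so the absolute values telescope. -/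
theorem sum_abs_displacement (h : DiffData f g d w) (hx : x ∈ Icc (0 : ℝ) 1) (n : ℕ) :
    ∑ k ∈ Finset.range n, |f^[k] (f x) - f^[k] x| = |f^[n] x - x| := by
  have hfx := h.mapsTo hx
  rcases le_total x (f x) with hxf | hxf
  · have h1 : ∀ k, f^[k] x ≤ f^[k] (f x) := fun k =>
      (h.strictMonoOn_iterate k).monotoneOn hx hfx hxf
    have h2 : x ≤ f^[n] x := monotone_nat_of_le_succ (f := fun k => f^[k] x) h1 (Nat.zero_le n)
    rw [abs_of_nonneg (sub_nonneg.2 h2)]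
    exact (Finset.sum_congr rfl fun k _ => abs_of_nonneg (sub_nonneg.2 (h1 k))).trans
      (Finset.sum_range_sub (fun k => f^[k] x) n)
  · have h1 : ∀ k, f^[k] (f x) ≤ f^[k] x := fun k =>
      (h.strictMonoOn_iterate k).monotoneOn hfx hx hxf
    have h2 : f^[n] x ≤ x := antitone_nat_of_succ_le (f := fun k => f^[k] x) h1 (Nat.zero_le n)
    rw [abs_of_nonpos (sub_nonpos.2 h2),
      Finset.sum_congr rfl fun k _ => abs_of_nonpos (sub_nonpos.2 (h1 k)), Finset.sum_neg_distrib]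
    exact congrArg Neg.neg (Finset.sum_range_sub (fun k => f^[k] x) n)

theorem abs_sub_le_one {a b : ℝ} (ha : a ∈ Icc (0 : ℝ) 1) (hb : b ∈ Icc (0 : ℝ) 1) :
    |a - b| ≤ 1 := abs_le.2 ⟨by linarith [ha.1, hb.2], by linarith [ha.2, hb.1]⟩

theorem abs_iterate_sub_le (h : DiffData f g d w) (hx : x ∈ Icc (0 : ℝ) 1)
    (hz : z ∈ uIcc x (f x)) (k : ℕ) : |f^[k] z - f^[k] x| ≤ |f^[k] (f x) - f^[k] x| :=
  abs_sub_left_of_mem_uIcc (h.iterate_mem_uIcc k hx (h.mapsTo hx) hz)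

theorem sum_abs_iterate_sub_le (h : DiffData f g d w) (hx : x ∈ Icc (0 : ℝ) 1)
    (hz : z ∈ Icc (0 : ℝ) 1) (ha : Adjacent f x z) (n : ℕ) :
    ∑ k ∈ Finset.range n, |f^[k] z - f^[k] x| ≤ 1 := by
  rcases ha with ha | ha
  · refine (Finset.sum_le_sum fun k _ => h.abs_iterate_sub_le hx ha k).trans ?_
    rw [h.sum_abs_displacement hx]
    exact abs_sub_le_one (h.iterate_mem n hx) hx
  · refine (Finset.sum_le_sum fun k _ => (abs_sub_comm _ _).trans_le
      (h.abs_iterate_sub_le hz ha k)).trans ?_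
    rw [h.sum_abs_displacement hz]
    exact abs_sub_le_one (h.iterate_mem n hz) hz

/-- Bounded distortion: the images of the interval between adjacent points do not overlap, so their
lengths sum to at most 1. -/
theorem abs_logIter_sub_le (h : DiffData f g d w) (hM0 : 0 ≤ M)
    (hM : ∀ x ∈ Icc (0 : ℝ) 1, |w x| ≤ M) (hx : x ∈ Icc (0 : ℝ) 1)
    (hz : z ∈ Icc (0 : ℝ) 1) (ha : Adjacent f x z) (n : ℕ) :
    |logIter f d n z - logIter f d n x| ≤ M := by
  rw [logIter, logIter, ← Finset.sum_sub_distrib]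
  refine (Finset.abs_sum_le_sum_abs _ _).trans ((Finset.sum_le_sum fun k _ =>
    h.abs_log_sub_le hM (h.iterate_mem k hx) (h.iterate_mem k hz)).trans ?_)
  rw [← Finset.mul_sum]
  exact mul_le_of_le_one_right hM0 (h.sum_abs_iterate_sub_le hx hz ha n)

theorem exp_logIter_le (h : DiffData f g d w) (hM0 : 0 ≤ M)
    (hM : ∀ x ∈ Icc (0 : ℝ) 1, |w x| ≤ M) (hx : x ∈ Icc (0 : ℝ) 1)
    (hz : z ∈ Icc (0 : ℝ) 1) (ha : Adjacent f x z) (n : ℕ) :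
    Real.exp (logIter f d n z) ≤ Real.exp M * Real.exp (logIter f d n x) := by
  rw [← Real.exp_add]
  apply Real.exp_le_exp.2
  linarith [(abs_le.1 (h.abs_logIter_sub_le hM0 hM hx hz ha n)).2]

/-- The mean value theorem gives the displacement as `Df^k` at some point adjacent to `x`, and
bounded distortion moves that derivative to `x`. -/
theorem exp_logIter_mul_le (h : DiffData f g d w) (hM0 : 0 ≤ M)
    (hM : ∀ x ∈ Icc (0 : ℝ) 1, |w x| ≤ M) (hx : x ∈ Icc (0 : ℝ) 1) (k : ℕ) :
    Real.exp (logIter f d k x) * |f x - x| ≤ Real.exp M * |f^[k] (f x) - f^[k] x| := by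
  obtain ⟨ξ, hξ, he⟩ := exists_mem_uIcc_sub_eq (fun y hy => h.hasDeriv_iterate k hy) hx
    (h.mapsTo hx)
  have hξI := uIcc_subset_unit hx (h.mapsTo hx) hξ
  rw [he, abs_mul, abs_of_pos (Real.exp_pos _), ← mul_assoc]
  gcongr
  exact h.exp_logIter_le hM0 hM hξI hx (Or.inr hξ) k

theorem sum_exp_logIter_mul_le (h : DiffData f g d w) (hM0 : 0 ≤ M)
    (hM : ∀ x ∈ Icc (0 : ℝ) 1, |w x| ≤ M) (hx : x ∈ Icc (0 : ℝ) 1) (n : ℕ) :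
    (∑ k ∈ Finset.range n, Real.exp (logIter f d k x)) * |f x - x| ≤
      Real.exp M * |f^[n] x - x| := by
  rw [← h.sum_abs_displacement hx, Finset.mul_sum, Finset.sum_mul]
  exact Finset.sum_le_sum fun k _ => h.exp_logIter_mul_le hM0 hM hx k

theorem summable_exp_logIter (h : DiffData f g d w) (hx : x ∈ Icc (0 : ℝ) 1) (hfx : f x ≠ x) :
    Summable fun k => Real.exp (logIter f d k x) := by
  obtain ⟨M, hM0, hM⟩ := h.exists_bound
  have hpos : 0 < |f x - x| := abs_pos.2 (sub_ne_zero.2 hfx)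
  refine summable_of_sum_range_le (c := Real.exp M / |f x - x|) (fun _ => (Real.exp_pos _).le)
    fun n => ?_
  rw [le_div_iff₀ hpos]
  exact (h.sum_exp_logIter_mul_le hM0 hM hx n).trans (mul_le_of_le_one_right (Real.exp_pos _).le
    (abs_sub_le_one (h.iterate_mem n hx) hx))

/-- If `f` moves `x` towards the fixed point `p`, the whole forward orbit stays between. -/
theorem abs_iterate_sub_le_of_toward (h : DiffData f g d w) (hx : x ∈ Icc (0 : ℝ) 1) {p : ℝ}
    (hp : p ∈ Icc (0 : ℝ) 1) (hfp : f p = p)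
    (hxp : (x ≤ p ∧ x ≤ f x) ∨ (p ≤ x ∧ f x ≤ x)) (n : ℕ) : |f^[n] x - x| ≤ |p - x| := by
  have hpn : f^[n] p = p := Function.iterate_fixed hfp n
  have hmono := (h.strictMonoOn_iterate n).monotoneOn
  apply abs_sub_left_of_mem_uIcc
  rcases hxp with ⟨h1, h2⟩ | ⟨h1, h2⟩
  · have h3 : x ≤ f^[n] x := monotone_nat_of_le_succ (f := fun k => f^[k] x)
      (fun k => (h.strictMonoOn_iterate k).monotoneOn hx (h.mapsTo hx) h2) (Nat.zero_le n)
    exact mem_uIcc.2 (Or.inl ⟨h3, (hmono hx hp h1).trans_eq hpn⟩)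
  · have h3 : f^[n] x ≤ x := antitone_nat_of_succ_le (f := fun k => f^[k] x)
      (fun k => (h.strictMonoOn_iterate k).monotoneOn (h.mapsTo hx) hx h2) (Nat.zero_le n)
    exact mem_uIcc.2 (Or.inr ⟨hpn.symm.trans_le (hmono hp hx h1), h3⟩)

/-- A fixed point ahead of `x` caps the forward orbit, so its total displacement is at most `|p -
x|` rather than merely 1. This is the gain that yields flatness. -/
theorem abs_orbitSum_mul_le (h : DiffData f g d w) (hM0 : 0 ≤ M)
    (hM : ∀ x ∈ Icc (0 : ℝ) 1, |w x| ≤ M) (hx : x ∈ Icc (0 : ℝ) 1) (hfx : f x ≠ x) {p : ℝ}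
    (hp : p ∈ Icc (0 : ℝ) 1) (hfp : f p = p)
    (hxp : (x ≤ p ∧ x ≤ f x) ∨ (p ≤ x ∧ f x ≤ x)) :
    |orbitSum f d w x| * |f x - x| ≤ M * Real.exp M * |p - x| := by
  have hpos : 0 < |f x - x| := abs_pos.2 (sub_ne_zero.2 hfx)
  have hs := h.summable_exp_logIter hx hfx
  have h1 : ‖orbitSum f d w x‖ ≤ ∑' k, M * Real.exp (logIter f d k x) := by
    refine tsum_of_norm_bounded (hs.mul_left M).hasSum fun k => ?_
    rw [Real.norm_eq_abs, abs_mul, abs_of_pos (Real.exp_pos _)]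
    gcongr
    exact hM _ (h.iterate_mem k hx)
  have h2 : ∑' k, Real.exp (logIter f d k x) ≤ Real.exp M * |p - x| / |f x - x| := by
    refine hs.tsum_le_of_sum_range_le fun n => ?_
    rw [le_div_iff₀ hpos]
    exact (h.sum_exp_logIter_mul_le hM0 hM hx n).trans (mul_le_mul_of_nonneg_left
      (h.abs_iterate_sub_le_of_toward hx hp hfp hxp n) (Real.exp_pos _).le)
  rw [tsum_mul_left, Real.norm_eq_abs] at h1
  rw [le_div_iff₀ hpos] at h2
  calc |orbitSum f d w x| * |f x - x| ≤ M * (∑' k, Real.exp (logIter f d k x)) * |f x - x| := by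
        gcongr
    _ = M * ((∑' k, Real.exp (logIter f d k x)) * |f x - x|) := by ring
    _ ≤ M * (Real.exp M * |p - x|) := by gcongr
    _ = _ := by ring

theorem mem_Ioo_of_ne (h : DiffData f g d w) (hx : x ∈ Icc (0 : ℝ) 1) (hfx : f x ≠ x) :
    x ∈ Ioo (0 : ℝ) 1 := by
  refine ⟨lt_of_le_of_ne hx.1 ?_, lt_of_le_of_ne hx.2 ?_⟩
  · rintro rfl; exact hfx h.map_zero
  · rintro rfl; exact hfx h.map_one

/-- Points close to a non-fixed point are adjacent to it and are not fixed. -/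
theorem exists_ball_adjacent (h : DiffData f g d w) (hx : x ∈ Icc (0 : ℝ) 1) (hfx : f x ≠ x) :
    ∃ ε > 0, ∀ z ∈ Metric.ball x ε, z ∈ Ioo (0 : ℝ) 1 ∧ f z ≠ z ∧ Adjacent f x z := by
  have hx' := h.mem_Ioo_of_ne hx hfx
  have hc : ContinuousAt f x := h.continuousOn.continuousAt (Icc_mem_nhds hx'.1 hx'.2)
  refine Metric.eventually_nhds_iff_ball.1 ?_
  refine Eventually.and (Ioo_mem_nhds hx'.1 hx'.2) (Eventually.and
    (((hc.sub continuousAt_id).eventually_ne (sub_ne_zero.2 hfx)).mono fun z => sub_ne_zero.1) ?_)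
  rcases lt_or_gt_of_ne hfx with hlt | hlt
  · filter_upwards [lt_mem_nhds hlt, hc.eventually (gt_mem_nhds hlt)] with z h1 h2
    rcases le_total z x with hzx | hzx
    · exact Or.inl (mem_uIcc.2 (Or.inr ⟨h1.le, hzx⟩))
    · exact Or.inr (mem_uIcc.2 (Or.inr ⟨h2.le, hzx⟩))
  · filter_upwards [gt_mem_nhds hlt, hc.eventually (lt_mem_nhds hlt)] with z h1 h2
    rcases le_total z x with hzx | hzx
    · exact Or.inr (mem_uIcc.2 (Or.inl ⟨hzx, h2.le⟩))
    · exact Or.inl (mem_uIcc.2 (Or.inl ⟨hzx, h1.le⟩))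

theorem hasDerivWithinAt_log_iterate (h : DiffData f g d w) (k : ℕ) (hx : x ∈ Icc (0 : ℝ) 1) :
    HasDerivWithinAt (fun y => Real.log (d (f^[k] y)))
      (w (f^[k] x) * Real.exp (logIter f d k x)) (Icc 0 1) x :=
  (h.hasDeriv_log _ (h.iterate_mem k hx)).comp x (h.hasDeriv_iterate k hx) (h.mapsTo.iterate k)

theorem summable_log_sub (h : DiffData f g d w) (hx : x ∈ Icc (0 : ℝ) 1)
    (hz : z ∈ Icc (0 : ℝ) 1) (ha : Adjacent f x z) :
    Summable fun k => Real.log (d (f^[k] z)) - Real.log (d (f^[k] x)) := by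
  obtain ⟨M, hM0, hM⟩ := h.exists_bound
  have h1 : Summable fun k => |f^[k] z - f^[k] x| :=
    summable_of_sum_range_le (fun _ => abs_nonneg _) (h.sum_abs_iterate_sub_le hx hz ha)
  exact .of_norm_bounded (h1.mul_left M) fun k =>
    h.abs_log_sub_le hM (h.iterate_mem k hx) (h.iterate_mem k hz)

/-- Near `x` all points are adjacent to `x`, so bounded distortion dominates the differentiated
series by a summable one, uniformly. -/
theorem hasDerivAt_tsum_log_sub (h : DiffData f g d w) (hx : x ∈ Icc (0 : ℝ) 1)
    (hfx : f x ≠ x) :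
    HasDerivAt (fun z => ∑' k, (Real.log (d (f^[k] z)) - Real.log (d (f^[k] x))))
      (orbitSum f d w x) x ∧ ContinuousAt (orbitSum f d w) x := by
  obtain ⟨M, hM0, hM⟩ := h.exists_bound
  obtain ⟨ε, hε, hball⟩ := h.exists_ball_adjacent hx hfx
  have hu : Summable fun k => M * (Real.exp M * Real.exp (logIter f d k x)) :=
    ((h.summable_exp_logIter hx hfx).mul_left _).mul_left _
  have hbd : ∀ (k : ℕ), ∀ y ∈ Metric.ball x ε, ‖w (f^[k] y) * Real.exp (logIter f d k y)‖ ≤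
      M * (Real.exp M * Real.exp (logIter f d k x)) := by
    intro k y hy
    obtain ⟨hyI, -, hya⟩ := hball y hy
    have hyI := Ioo_subset_Icc_self hyI
    rw [Real.norm_eq_abs, abs_mul, abs_of_pos (Real.exp_pos _)]
    gcongr
    · exact hM _ (h.iterate_mem k hyI)
    · exact h.exp_logIter_le hM0 hM hx hyI hya k
  constructor
  · refine hasDerivAt_tsum_of_isPreconnected hu Metric.isOpen_ball
      (convex_ball x ε).isPreconnected (fun k y hy => ?_) hbd (Metric.mem_ball_self hε)
      (by simp) (Metric.mem_ball_self hε)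
    obtain ⟨hyI, -, -⟩ := hball y hy
    exact ((h.hasDerivWithinAt_log_iterate k (Ioo_subset_Icc_self hyI)).hasDerivAt
      (Icc_mem_nhds hyI.1 hyI.2)).sub_const _
  · have hsub : Metric.ball x ε ⊆ Icc 0 1 := fun y hy => Ioo_subset_Icc_self (hball y hy).1
    refine (continuousOn_tsum (fun k => ?_) hu hbd).continuousAt (Metric.ball_mem_nhds x hε)
    have hit : ∀ j : ℕ, ContinuousOn f^[j] (Icc 0 1) := fun j y hy =>
      (h.hasDeriv_iterate j hy).continuousWithinAt
    refine ContinuousOn.mono (ContinuousOn.mul (h.cont.comp (hit k) (h.mapsTo.iterate k)) ?_) hsub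
    refine ContinuousOn.rexp (continuousOn_finsetSum _ fun j _ => ?_)
    exact h.continuousOn_log.comp (hit j) (h.mapsTo.iterate j)

end DiffData
/-! ### The Szekeres vector field -/

/-- Increments of the logarithm of `n ↦ (f^(n+1) x - f^n x) / Df^n x`. -/
noncomputable def szekeresTerm (f d : ℝ → ℝ) (x : ℝ) (k : ℕ) : ℝ :=
  Real.log ((f^[k + 1] (f x) - f^[k + 1] x) / (f^[k] (f x) - f^[k] x)) - Real.log (d (f^[k] x))

/-- The Szekeres vector field `x ↦ lim (f^(n+1) x - f^n x) / Df^n x`. -/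
noncomputable def szekeres (f d : ℝ → ℝ) (x : ℝ) : ℝ :=
  (f x - x) * Real.exp (∑' k, szekeresTerm f d x k)

theorem szekeres_of_fixed {f : ℝ → ℝ} (d : ℝ → ℝ) {x : ℝ} (hfx : f x = x) :
    szekeres f d x = 0 := by simp [szekeres, hfx]

theorem logIter_succ' (f d : ℝ → ℝ) (n : ℕ) (x : ℝ) :
    logIter f d (n + 1) x = Real.log (d x) + logIter f d n (f x) := by
  rw [add_comm n 1, logIter_add]
  simp [logIter]

namespace DiffData
variable {f g d w : ℝ → ℝ} {M : ℝ} {x z : ℝ}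

theorem iterate_map_sub_ne_zero (h : DiffData f g d w) (hx : x ∈ Icc (0 : ℝ) 1)
    (hfx : f x ≠ x) (k : ℕ) : f^[k] (f x) - f^[k] x ≠ 0 := fun hc =>
  hfx ((h.strictMonoOn_iterate k).injOn (h.mapsTo hx) hx (sub_eq_zero.1 hc))

theorem exists_iterate_succ_sub_eq (h : DiffData f g d w) (hx : x ∈ Icc (0 : ℝ) 1)
    (hz : z ∈ Icc (0 : ℝ) 1) (k : ℕ) :
    ∃ ξ ∈ Icc (0 : ℝ) 1, ξ ∈ uIcc (f^[k] x) (f^[k] z) ∧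
      f^[k + 1] z - f^[k + 1] x = d ξ * (f^[k] z - f^[k] x) := by
  obtain ⟨ξ, hξ, he⟩ := exists_mem_uIcc_sub_eq h.hasDeriv (h.iterate_mem k hx) (h.iterate_mem k hz)
  refine ⟨ξ, uIcc_subset_unit (h.iterate_mem k hx) (h.iterate_mem k hz) hξ, hξ, ?_⟩
  rw [Function.iterate_succ_apply', Function.iterate_succ_apply', he]

/-- By the mean value theorem the ratio is `d ξ` with `ξ` between `f^[k] x` and its image, so the
term is an increment of `log d`. -/
theorem abs_szekeresTerm_le (h : DiffData f g d w)
    (hM : ∀ x ∈ Icc (0 : ℝ) 1, |w x| ≤ M) (hM0 : 0 ≤ M) (hx : x ∈ Icc (0 : ℝ) 1)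
    (hfx : f x ≠ x) (k : ℕ) :
    |szekeresTerm f d x k| ≤ M * |f^[k] (f x) - f^[k] x| := by
  obtain ⟨ξ, hξI, hξ, he⟩ := h.exists_iterate_succ_sub_eq hx (h.mapsTo hx) k
  rw [szekeresTerm, he, mul_div_cancel_right₀ _ (h.iterate_map_sub_ne_zero hx hfx k)]
  exact (h.abs_log_sub_le hM (h.iterate_mem k hx) hξI).trans
    (mul_le_mul_of_nonneg_left (abs_sub_left_of_mem_uIcc hξ) hM0)

theorem sum_abs_szekeresTerm_le (h : DiffData f g d w)
    (hM : ∀ x ∈ Icc (0 : ℝ) 1, |w x| ≤ M) (hM0 : 0 ≤ M) (hx : x ∈ Icc (0 : ℝ) 1)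
    (hfx : f x ≠ x) (n : ℕ) : ∑ k ∈ Finset.range n, |szekeresTerm f d x k| ≤ M := by
  refine (Finset.sum_le_sum fun k _ => h.abs_szekeresTerm_le hM hM0 hx hfx k).trans ?_
  rw [← Finset.mul_sum, h.sum_abs_displacement hx]
  exact mul_le_of_le_one_right hM0 (abs_sub_le_one (h.iterate_mem n hx) hx)

theorem summable_szekeresTerm (h : DiffData f g d w) (hx : x ∈ Icc (0 : ℝ) 1)
    (hfx : f x ≠ x) : Summable (szekeresTerm f d x) := by
  obtain ⟨M, hM0, hM⟩ := h.exists_bound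
  exact Summable.of_abs (summable_of_sum_range_le (fun _ => abs_nonneg _)
    (h.sum_abs_szekeresTerm_le hM hM0 hx hfx))

theorem abs_tsum_szekeresTerm_le (h : DiffData f g d w)
    (hM : ∀ x ∈ Icc (0 : ℝ) 1, |w x| ≤ M) (hM0 : 0 ≤ M) (hx : x ∈ Icc (0 : ℝ) 1)
    (hfx : f x ≠ x) : |∑' k, szekeresTerm f d x k| ≤ M := by
  refine le_of_tendsto ((h.summable_szekeresTerm hx hfx).hasSum.tendsto_sum_nat.abs)
    (Eventually.of_forall fun n => ?_)
  exact (Finset.abs_sum_le_sum_abs _ _).trans (h.sum_abs_szekeresTerm_le hM hM0 hx hfx n)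

theorem sub_mul_exp_sum_szekeresTerm (h : DiffData f g d w) (hx : x ∈ Icc (0 : ℝ) 1)
    (hfx : f x ≠ x) (n : ℕ) :
    (f x - x) * Real.exp (∑ k ∈ Finset.range n, szekeresTerm f d x k) =
      (f^[n] (f x) - f^[n] x) * Real.exp (-logIter f d n x) := by
  induction n with
  | zero => simp [logIter]
  | succ n ih =>
    obtain ⟨ξ, hξI, hξ, he⟩ := h.exists_iterate_succ_sub_eq hx (h.mapsTo hx) n
    rw [Finset.sum_range_succ, Real.exp_add, ← mul_assoc, ih, szekeresTerm, he,
      mul_div_cancel_right₀ _ (h.iterate_map_sub_ne_zero hx hfx n), logIter_succ, neg_add,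
      Real.exp_add, sub_eq_add_neg (Real.log _), Real.exp_add, Real.exp_log (h.pos _ hξI)]
    ring

theorem tendsto_szekeres (h : DiffData f g d w) (hx : x ∈ Icc (0 : ℝ) 1) :
    Tendsto (fun n => (f^[n] (f x) - f^[n] x) * Real.exp (-logIter f d n x)) atTop
      (𝓝 (szekeres f d x)) := by
  by_cases hfx : f x = x
  · simp [szekeres, hfx]
  · refine Tendsto.congr (h.sub_mul_exp_sum_szekeresTerm hx hfx) (Tendsto.const_mul _ ?_)
    exact (Real.continuous_exp.tendsto _).comp
      (h.summable_szekeresTerm hx hfx).hasSum.tendsto_sum_nat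

/-- The `n`-th quotient at `f x` is `d x` times the `(n+1)`-st quotient at `x`. -/
theorem szekeres_map (h : DiffData f g d w) (hx : x ∈ Icc (0 : ℝ) 1) :
    szekeres f d (f x) = d x * szekeres f d x := by
  refine tendsto_nhds_unique (h.tendsto_szekeres (h.mapsTo hx))
    ((((tendsto_add_atTop_iff_nat 1).2 (h.tendsto_szekeres hx)).const_mul (d x)).congr fun n => ?_)
  rw [logIter_succ', neg_add, Real.exp_add, Real.exp_neg (Real.log _), Real.exp_log (h.pos x hx)]
  have := (h.pos x hx).ne'
  simp only [Function.iterate_succ_apply]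
  field_simp

theorem abs_szekeres_le (h : DiffData f g d w)
    (hM : ∀ x ∈ Icc (0 : ℝ) 1, |w x| ≤ M) (hM0 : 0 ≤ M) (hx : x ∈ Icc (0 : ℝ) 1) :
    |szekeres f d x| ≤ Real.exp M * |f x - x| := by
  by_cases hfx : f x = x
  · simp [szekeres, hfx]
  · rw [szekeres, abs_mul, abs_of_pos (Real.exp_pos _), mul_comm]
    gcongr
    exact (abs_le.1 (h.abs_tsum_szekeresTerm_le hM hM0 hx hfx)).2

/-- The logarithm of the quotient is a tail of the convergent series defining `szekeres f d x`. -/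
theorem tendsto_szekeres_iterate_div (h : DiffData f g d w) (hx : x ∈ Icc (0 : ℝ) 1)
    (hfx : f x ≠ x) :
    Tendsto (fun n => szekeres f d (f^[n] x) / (f^[n] (f x) - f^[n] x)) atTop (𝓝 1) := by
  have h1 : Tendsto (fun n => Real.exp (∑' k, szekeresTerm f d x (k + n))) atTop
      (𝓝 (Real.exp 0)) := (Real.continuous_exp.tendsto _).comp (tendsto_sum_nat_add _)
  rw [Real.exp_zero] at h1
  refine h1.congr fun n => ?_
  have h3 : f (f^[n] x) = f^[n] (f x) := by
    rw [← Function.iterate_succ_apply, Function.iterate_succ_apply']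
  have h2 : ∀ k, szekeresTerm f d (f^[n] x) k = szekeresTerm f d x (k + n) := by
    intro k
    rw [szekeresTerm, szekeresTerm, h3]
    simp only [← Function.iterate_add_apply, Nat.add_right_comm k 1 n]
  rw [szekeres, h3, mul_div_cancel_left₀ _ (h.iterate_map_sub_ne_zero hx hfx n)]
  simp only [h2]

theorem exists_tendsto_iterate (h : DiffData f g d w) (hx : x ∈ Icc (0 : ℝ) 1) :
    ∃ p ∈ Icc (0 : ℝ) 1, f p = p ∧ Tendsto (fun n => f^[n] x) atTop (𝓝 p) := by
  have hex : ∃ p, Tendsto (fun n => f^[n] x) atTop (𝓝 p) := by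
    rcases le_total x (f x) with hxf | hxf
    · exact ⟨_, tendsto_atTop_ciSup (monotone_nat_of_le_succ fun k =>
        (h.strictMonoOn_iterate k).monotoneOn hx (h.mapsTo hx) hxf)
        ⟨1, by rintro _ ⟨n, rfl⟩; exact (h.iterate_mem n hx).2⟩⟩
    · exact ⟨_, tendsto_atTop_ciInf (antitone_nat_of_succ_le fun k =>
        (h.strictMonoOn_iterate k).monotoneOn (h.mapsTo hx) hx hxf)
        ⟨0, by rintro _ ⟨n, rfl⟩; exact (h.iterate_mem n hx).1⟩⟩
  obtain ⟨p, hp⟩ := hex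
  have hpI : p ∈ Icc (0 : ℝ) 1 :=
    isClosed_Icc.mem_of_tendsto hp (Eventually.of_forall fun n => h.iterate_mem n hx)
  refine ⟨p, hpI, ?_, hp⟩
  have h1 : Tendsto (fun n => f (f^[n] x)) atTop (𝓝 (f p)) :=
    (h.continuousOn p hpI).tendsto.comp (tendsto_nhdsWithin_iff.2
      ⟨hp, Eventually.of_forall fun n => h.iterate_mem n hx⟩)
  refine tendsto_nhds_unique h1 (((tendsto_add_atTop_iff_nat 1).2 hp).congr fun n => ?_)
  rw [Function.iterate_succ_apply']

theorem tendsto_of_mem_uIcc {a b c : ℕ → ℝ} {p : ℝ} (ha : Tendsto a atTop (𝓝 p))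
    (hb : Tendsto b atTop (𝓝 p)) (hc : ∀ n, c n ∈ uIcc (a n) (b n)) :
    Tendsto c atTop (𝓝 p) := by
  have h1 := ha.min hb
  have h2 := ha.max hb
  rw [min_self] at h1
  rw [max_self] at h2
  exact tendsto_of_tendsto_of_tendsto_of_le_of_le h1 h2 (fun n => (hc n).1) fun n => (hc n).2

theorem szekeres_eq_mul_exp_aux (h : DiffData f g d w)
    (hpar : ∀ p ∈ Icc (0 : ℝ) 1, f p = p → d p = 1) (hx : x ∈ Icc (0 : ℝ) 1) (hfx : f x ≠ x)
    (hz : z ∈ uIcc x (f x)) :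
    szekeres f d z = szekeres f d x *
      Real.exp (-∑' k, (Real.log (d (f^[k] z)) - Real.log (d (f^[k] x)))) := by
  have hfxI := h.mapsTo hx
  have hzI := uIcc_subset_unit hx hfxI hz
  obtain ⟨p, hpI, hfp, hp⟩ := h.exists_tendsto_iterate hx
  have hpf : Tendsto (fun n => f^[n] (f x)) atTop (𝓝 p) := (tendsto_add_atTop_iff_nat 1).2 hp
  choose ξ hξI hξ he using fun n => h.exists_iterate_succ_sub_eq hx hzI n
  have hzm := fun n => h.iterate_mem_uIcc n hx hfxI hz
  have hξp : Tendsto ξ atTop (𝓝 p) :=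
    tendsto_of_mem_uIcc hp (tendsto_of_mem_uIcc hp hpf hzm) hξ
  have hdξ : Tendsto (fun n => d (ξ n) - 1) atTop (𝓝 0) := by
    have := (h.continuousOn_d p hpI).tendsto.comp (tendsto_nhdsWithin_iff.2
      ⟨hξp, Eventually.of_forall hξI⟩)
    rw [hpar p hpI hfp] at this
    simpa using this.sub_const 1
  have hratio : Tendsto (fun n => (f^[n] (f z) - f^[n] z) / (f^[n] (f x) - f^[n] x)) atTop
      (𝓝 1) := by
    rw [← tendsto_sub_nhds_zero_iff]
    refine squeeze_zero_norm (fun n => ?_) (by simpa using hdξ.abs)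
    have hne := h.iterate_map_sub_ne_zero hx hfx n
    -- The displacements of `z` and `x` differ by `(d ξ - 1)` times `f^[n] z - f^[n] x`, which is no
    -- longer than the displacement of `x`. Parabolicity of the limit point sends `d ξ - 1` to zero.
    have h1 : (f^[n] (f z) - f^[n] z) / (f^[n] (f x) - f^[n] x) - 1 =
        (d (ξ n) - 1) * ((f^[n] z - f^[n] x) / (f^[n] (f x) - f^[n] x)) := by
      have := he n
      simp only [Function.iterate_succ_apply] at this
      field_simp
      linarith
    rw [h1, Real.norm_eq_abs, abs_mul]
    refine mul_le_of_le_one_right (abs_nonneg _) ?_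
    rw [abs_div]
    exact div_le_one_of_le₀ (abs_sub_left_of_mem_uIcc (hzm n)) (abs_nonneg _)
  have hexp : Tendsto (fun n => Real.exp (-(logIter f d n z - logIter f d n x))) atTop
      (𝓝 (Real.exp (-∑' k, (Real.log (d (f^[k] z)) - Real.log (d (f^[k] x)))))) := by
    refine (Real.continuous_exp.tendsto _).comp (Tendsto.neg ?_)
    refine ((h.summable_log_sub hx hzI (Or.inl hz)).hasSum.tendsto_sum_nat).congr fun n => ?_
    rw [Finset.sum_sub_distrib, logIter, logIter]
  have hlim := ((h.tendsto_szekeres hx).mul (hratio.mul hexp))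
  rw [one_mul] at hlim
  refine tendsto_nhds_unique (h.tendsto_szekeres hzI) (hlim.congr fun n => ?_)
  have hne := h.iterate_map_sub_ne_zero hx hfx n
  rw [neg_sub, sub_eq_add_neg (logIter f d n x), Real.exp_add, Real.exp_neg (logIter f d n x)]
  have := (Real.exp_pos (logIter f d n x)).ne'
  field_simp

/-- If all fixed points are parabolic, the Szekeres vector field has an explicit logarithm. -/
theorem szekeres_eq_mul_exp (h : DiffData f g d w)
    (hpar : ∀ p ∈ Icc (0 : ℝ) 1, f p = p → d p = 1) (hx : x ∈ Icc (0 : ℝ) 1) (hfx : f x ≠ x)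
    (hz : z ∈ Icc (0 : ℝ) 1) (hfz : f z ≠ z) (ha : Adjacent f x z) :
    szekeres f d z = szekeres f d x *
      Real.exp (-∑' k, (Real.log (d (f^[k] z)) - Real.log (d (f^[k] x)))) := by
  rcases ha with ha | ha
  · exact h.szekeres_eq_mul_exp_aux hpar hx hfx ha
  · rw [h.szekeres_eq_mul_exp_aux hpar hz hfz ha, mul_assoc, ← Real.exp_add]
    have : ∑' k, (Real.log (d (f^[k] x)) - Real.log (d (f^[k] z))) =
        -∑' k, (Real.log (d (f^[k] z)) - Real.log (d (f^[k] x))) := by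
      rw [← tsum_neg]
      simp
    rw [this]
    simp

theorem hasDerivAt_szekeres (h : DiffData f g d w)
    (hpar : ∀ p ∈ Icc (0 : ℝ) 1, f p = p → d p = 1) (hx : x ∈ Icc (0 : ℝ) 1) (hfx : f x ≠ x) :
    HasDerivAt (szekeres f d) (-(szekeres f d x * orbitSum f d w x)) x := by
  obtain ⟨ε, hε, hball⟩ := h.exists_ball_adjacent hx hfx
  have h1 := ((h.hasDerivAt_tsum_log_sub hx hfx).1.neg.exp).const_mul (szekeres f d x)
  simp only [Pi.neg_apply, sub_self, tsum_zero, neg_zero, Real.exp_zero, one_mul, mul_neg] at h1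
  refine h1.congr_of_eventuallyEq ?_
  filter_upwards [Metric.ball_mem_nhds x hε] with z hz
  obtain ⟨hzI, hfz, ha⟩ := hball z hz
  exact h.szekeres_eq_mul_exp hpar hx hfx (Ioo_subset_Icc_self hzI) hfz ha

end DiffData
/-! ### Consequences of vanishing asymptotic distortion -/

namespace DiffData
variable {f g d w : ℝ → ℝ} {M : ℝ} {x z : ℝ}

theorem abs_logIter_sub_le_varLogDeriv (h : DiffData f g d w) (n : ℕ) (hx : x ∈ Icc (0 : ℝ) 1)
    (hz : z ∈ Icc (0 : ℝ) 1) :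
    |logIter f d n x - logIter f d n z| ≤ (varLogDeriv f^[n]).toReal := by
  have hb : BoundedVariationOn (logIter f d n) (Icc 0 1) := by
    rw [BoundedVariationOn, ← h.varLogDeriv_iterate]
    exact h.varLogDeriv_iterate_ne_top n
  rw [h.varLogDeriv_iterate]
  exact hb.dist_le hx hz

/-- Undistorted diffeomorphisms have parabolic fixed points. -/
theorem deriv_eq_one_of_fixed (h : DiffData f g d w)
    (hL : Tendsto (fun n : ℕ => (varLogDeriv f^[n]).toReal / n) atTop (𝓝 0)) {p : ℝ}
    (hp : p ∈ Icc (0 : ℝ) 1) (hfp : f p = p) : d p = 1 := by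
  have hlog : |Real.log (d p)| ≤ 0 := by
    refine ge_of_tendsto hL ?_
    filter_upwards [eventually_gt_atTop 0] with n hn
    have hn' : (0 : ℝ) < n := by exact_mod_cast hn
    have h0 : (0 : ℝ) ∈ Icc (0 : ℝ) 1 := by simp
    have h1 : (1 : ℝ) ∈ Icc (0 : ℝ) 1 := by simp
    -- Since `f^[n]` fixes 0 and 1, its derivative equals 1 somewhere; hence `n |log (d p)|` is at
    -- most the variation.
    obtain ⟨ξ, hξ, he⟩ := exists_mem_uIcc_sub_eq (fun y hy => h.hasDeriv_iterate n hy) h0 h1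
    rw [Function.iterate_fixed h.map_zero, Function.iterate_fixed h.map_one, sub_zero, mul_one,
      eq_comm, Real.exp_eq_one_iff] at he
    have hb := h.abs_logIter_sub_le_varLogDeriv n hp (uIcc_subset_unit h0 h1 hξ)
    have hpn : logIter f d n p = n * Real.log (d p) := by
      simp [logIter, Function.iterate_fixed hfp]
    rw [he, sub_zero, hpn, abs_mul, Nat.abs_cast] at hb
    rw [le_div_iff₀ hn']
    linarith
  exact Real.eq_one_of_pos_of_log_eq_zero (h.pos p hp) (abs_nonpos_iff.1 hlog)

/-- The intervals from `f^[m] x` to `f^[m+1] x` have disjoint interiors, and each contains one pair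
of points, so the variations over them add up. -/
theorem sum_edist_iterate_le (h : DiffData f g d w) (u : ℝ → ℝ) (hx : x ∈ Icc (0 : ℝ) 1)
    (hz : z ∈ uIcc x (f x)) (N : ℕ) :
    ∑ m ∈ Finset.range N, edist (u (f^[m] z)) (u (f^[m] x)) ≤ eVariationOn u (Icc 0 1) := by
  have hfx := h.mapsTo hx
  have hmem := fun m => h.iterate_mem_uIcc m hx hfx hz
  rcases le_total x (f x) with hxf | hxf
  · have h1 : ∀ k, f^[k] x ≤ f^[k] (f x) := fun k =>
      (h.strictMonoOn_iterate k).monotoneOn hx hfx hxf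
    have h2 : ∀ k, x ≤ f^[k] x := fun k =>
      monotone_nat_of_le_succ (f := fun k => f^[k] x) h1 (Nat.zero_le k)
    have key : ∑ m ∈ Finset.range N, edist (u (f^[m] z)) (u (f^[m] x)) ≤
        eVariationOn u (Icc x (f^[N] x)) := by
      induction N with
      | zero => simp
      | succ N ih =>
        have h3 := eVariationOn.Icc_add_Icc u (s := univ) (h2 N) (h1 N) (mem_univ _)
        simp only [univ_inter] at h3
        rw [Finset.sum_range_succ, Function.iterate_succ_apply, ← h3]
        refine add_le_add ih (eVariationOn.edist_le _ ?_ (left_mem_Icc.2 (h1 N)))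
        rw [← uIcc_of_le (h1 N)]
        exact hmem N
    exact key.trans (eVariationOn.mono _ (Icc_subset_Icc hx.1 (h.iterate_mem N hx).2))
  · have h1 : ∀ k, f^[k] (f x) ≤ f^[k] x := fun k =>
      (h.strictMonoOn_iterate k).monotoneOn hfx hx hxf
    have h2 : ∀ k, f^[k] x ≤ x := fun k =>
      antitone_nat_of_succ_le (f := fun k => f^[k] x) h1 (Nat.zero_le k)
    have key : ∑ m ∈ Finset.range N, edist (u (f^[m] z)) (u (f^[m] x)) ≤
        eVariationOn u (Icc (f^[N] x) x) := by
      induction N with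
      | zero => simp
      | succ N ih =>
        have h3 := eVariationOn.Icc_add_Icc u (s := univ) (h1 N) (h2 N) (mem_univ _)
        simp only [univ_inter] at h3
        rw [Finset.sum_range_succ, Function.iterate_succ_apply, ← h3, add_comm]
        refine add_le_add (eVariationOn.edist_le _ ?_ (right_mem_Icc.2 (h1 N))) ih
        rw [← uIcc_of_ge (h1 N)]
        exact hmem N
    exact key.trans (eVariationOn.mono _ (Icc_subset_Icc (h.iterate_mem N hx).1 hx.2))

/-! ### Forward and backward orbit sums agree. -/

theorem iterate_right_inv (h : DiffData f g d w) (m : ℕ) (hx : x ∈ Icc (0 : ℝ) 1) :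
    f^[m] (g^[m] x) = x := by
  induction m with
  | zero => rfl
  | succ m ih =>
    rw [Function.iterate_succ_apply, Function.iterate_succ_apply',
      h.right_inv _ (h.symm.iterate_mem m hx), ih]

theorem logIter_iterate_inv (h : DiffData f g d w) (m : ℕ) (hx : x ∈ Icc (0 : ℝ) 1) :
    logIter f d m (g^[m] x) = -logIter g (fun x => (d (g x))⁻¹) m x := by
  induction m with
  | zero => simp [logIter]
  | succ m ih =>
    rw [logIter_succ', Function.iterate_succ_apply', h.right_inv _ (h.symm.iterate_mem m hx), ih,
      logIter_succ, Real.log_inv]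
    ring

theorem mem_uIcc_inv (h : DiffData f g d w) (hx : x ∈ Icc (0 : ℝ) 1) (hz : z ∈ uIcc x (f x)) :
    x ∈ uIcc z (g z) := by
  have hzI := uIcc_subset_unit hx (h.mapsTo hx) hz
  have hmono := h.symm.strictMonoOn.monotoneOn
  rcases le_total x (f x) with hxf | hxf
  · rw [uIcc_of_le hxf] at hz
    exact mem_uIcc.2 (Or.inr ⟨(hmono hzI (h.mapsTo hx) hz.2).trans_eq (h.left_inv x hx), hz.1⟩)
  · rw [uIcc_of_ge hxf] at hz
    exact mem_uIcc.2 (Or.inl ⟨hz.2, (h.left_inv x hx).symm.trans_le (hmono (h.mapsTo hx) hzI hz.1)⟩)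

theorem adjacent_inv (h : DiffData f g d w) (hx : x ∈ Icc (0 : ℝ) 1) (hz : z ∈ Icc (0 : ℝ) 1)
    (ha : Adjacent f x z) : Adjacent g x z :=
  ha.elim (fun ha => Or.inr (h.mem_uIcc_inv hx ha)) fun ha => Or.inl (h.mem_uIcc_inv hz ha)

/-- At the points `g^[m] z` and `g^[m] x`, the values of `log Df^N` differ by `a (N - m) - b m`,
close to `A - B` for most `m < N`. These pairs lie in non-overlapping intervals, so `N |A - B|` is
at most `var (log Df^N) + o(N)`, and vanishing distortion gives `A = B`. -/
theorem tsum_log_sub_eq_inv_aux (h : DiffData f g d w)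
    (hL : Tendsto (fun n : ℕ => (varLogDeriv f^[n]).toReal / n) atTop (𝓝 0))
    (hx : x ∈ Icc (0 : ℝ) 1) (hz : z ∈ uIcc x (f x)) :
    ∑' k, (Real.log (d (f^[k] z)) - Real.log (d (f^[k] x))) =
      ∑' k, (Real.log (d (g (g^[k] z)))⁻¹ - Real.log (d (g (g^[k] x)))⁻¹) := by
  have hzI := uIcc_subset_unit hx (h.mapsTo hx) hz
  have hA := (h.summable_log_sub hx hzI (Or.inl hz)).hasSum.tendsto_sum_nat
  have hB := (h.symm.summable_log_sub hx hzI
    (h.adjacent_inv hx hzI (Or.inl hz))).hasSum.tendsto_sum_nat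
  set A := ∑' k, (Real.log (d (f^[k] z)) - Real.log (d (f^[k] x)))
  set B := ∑' k, (Real.log (d (g (g^[k] z)))⁻¹ - Real.log (d (g (g^[k] x)))⁻¹)
  set a : ℕ → ℝ := fun n => logIter f d n z - logIter f d n x with ha
  set b : ℕ → ℝ := fun n => logIter g (fun x => (d (g x))⁻¹) n z -
    logIter g (fun x => (d (g x))⁻¹) n x with hb
  -- The shift by one matches the indices `N - m`, which run over `1, …, N`.
  have hA' : Tendsto (fun n => |a (n + 1) - A|) atTop (𝓝 0) := by
    have : Tendsto a atTop (𝓝 A) := hA.congr fun n => by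
      simp only [ha, logIter, Finset.sum_sub_distrib]
    simpa using (((tendsto_add_atTop_iff_nat 1).2 this).sub_const A).abs
  have hB' : Tendsto (fun n => |b n - B|) atTop (𝓝 0) := by
    have : Tendsto b atTop (𝓝 B) := hB.congr fun n => by
      simp only [hb, logIter, Finset.sum_sub_distrib]
    simpa using (this.sub_const B).abs
  have hvar : ∀ N : ℕ, ∑ m ∈ Finset.range N, |a (N - m) - b m| ≤ (varLogDeriv f^[N]).toReal := by
    intro N
    have h1 := h.symm.sum_edist_iterate_le (logIter f d N) hzI (h.mem_uIcc_inv hx hz) N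
    rw [← h.varLogDeriv_iterate] at h1
    have h2 := ENNReal.toReal_mono (h.varLogDeriv_iterate_ne_top N) h1
    rw [ENNReal.toReal_sum fun m _ => edist_ne_top _ _] at h2
    refine le_trans (Finset.sum_le_sum fun m hm => le_of_eq ?_) h2
    have hmN : N = m + (N - m) := (Nat.add_sub_cancel' (Finset.mem_range.1 hm).le).symm
    rw [← dist_edist, dist_comm, Real.dist_eq]
    have h3 : ∀ y ∈ Icc (0 : ℝ) 1, logIter f d N (g^[m] y) =
        -logIter g (fun x => (d (g x))⁻¹) m y + logIter f d (N - m) y := by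
      intro y hy
      rw [← h.logIter_iterate_inv m hy]
      conv_lhs => rw [hmN, logIter_add, h.iterate_right_inv m hy]
    rw [h3 x hx, h3 z hzI]
    congr 1
    simp only [ha, hb]
    ring
  have hcesaro := (hL.add hA'.cesaro).add hB'.cesaro
  simp only [add_zero] at hcesaro
  have hle : |A - B| ≤ 0 := by
    refine ge_of_tendsto hcesaro ?_
    filter_upwards [eventually_gt_atTop 0] with N hN
    have hN' : (0 : ℝ) < N := by exact_mod_cast hN
    have h1 : N * |A - B| ≤ (varLogDeriv f^[N]).toReal +
        ∑ m ∈ Finset.range N, |a (m + 1) - A| + ∑ m ∈ Finset.range N, |b m - B| := by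
      have h2 : ∑ m ∈ Finset.range N, |a (m + 1) - A| =
          ∑ m ∈ Finset.range N, |a (N - m) - A| := by
        rw [← Finset.sum_range_reflect]
        refine Finset.sum_congr rfl fun m hm => ?_
        have := Finset.mem_range.1 hm
        rw [show N - 1 - m + 1 = N - m by omega]
      rw [h2]
      refine le_trans ?_ (add_le_add_left (add_le_add_left (hvar N) _) _)
      rw [← Finset.sum_add_distrib, ← Finset.sum_add_distrib]
      calc (N : ℝ) * |A - B| = ∑ m ∈ Finset.range N, |A - B| := by simp
        _ ≤ _ := Finset.sum_le_sum fun m _ => ?_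
      have h3 : A - B = (a (N - m) - b m) - (a (N - m) - A) + (b m - B) := by ring
      rw [h3]
      exact (abs_add_le _ _).trans (add_le_add_left (abs_sub _ _) _)
    have h4 : (varLogDeriv f^[N]).toReal / N +
        (N : ℝ)⁻¹ * ∑ m ∈ Finset.range N, |a (m + 1) - A| +
        (N : ℝ)⁻¹ * ∑ m ∈ Finset.range N, |b m - B| = ((varLogDeriv f^[N]).toReal +
        ∑ m ∈ Finset.range N, |a (m + 1) - A| + ∑ m ∈ Finset.range N, |b m - B|) / N := by
      field_simp
    rw [h4, le_div_iff₀ hN', mul_comm]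
    exact h1
  exact sub_eq_zero.1 (abs_nonpos_iff.1 hle)

/-- For an undistorted diffeomorphism, the forward and backward orbit sums agree. -/
theorem tsum_log_sub_eq_inv (h : DiffData f g d w)
    (hL : Tendsto (fun n : ℕ => (varLogDeriv f^[n]).toReal / n) atTop (𝓝 0))
    (hx : x ∈ Icc (0 : ℝ) 1) (hz : z ∈ Icc (0 : ℝ) 1) (ha : Adjacent f x z) :
    ∑' k, (Real.log (d (f^[k] z)) - Real.log (d (f^[k] x))) =
      ∑' k, (Real.log (d (g (g^[k] z)))⁻¹ - Real.log (d (g (g^[k] x)))⁻¹) := by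
  rcases ha with ha | ha
  · exact h.tsum_log_sub_eq_inv_aux hL hx ha
  · have h1 := congrArg Neg.neg (h.tsum_log_sub_eq_inv_aux hL hz ha)
    rw [← tsum_neg, ← tsum_neg] at h1
    simpa only [neg_sub] using h1

theorem inv_ne_of_ne (h : DiffData f g d w) (hx : x ∈ Icc (0 : ℝ) 1) (hfx : f x ≠ x) :
    g x ≠ x := fun hc => hfx (by conv_lhs => rw [← hc, h.right_inv x hx])

theorem orbitSum_eq_inv (h : DiffData f g d w)
    (hL : Tendsto (fun n : ℕ => (varLogDeriv f^[n]).toReal / n) atTop (𝓝 0))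
    (hx : x ∈ Icc (0 : ℝ) 1) (hfx : f x ≠ x) :
    orbitSum f d w x =
      orbitSum g (fun x => (d (g x))⁻¹) (fun x => -(w (g x) * (d (g x))⁻¹)) x := by
  obtain ⟨ε, hε, hball⟩ := h.exists_ball_adjacent hx hfx
  refine (h.hasDerivAt_tsum_log_sub hx hfx).1.unique
    ((h.symm.hasDerivAt_tsum_log_sub hx (h.inv_ne_of_ne hx hfx)).1.congr_of_eventuallyEq ?_)
  filter_upwards [Metric.ball_mem_nhds x hε] with z hz
  obtain ⟨hzI, -, ha⟩ := hball z hz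
  exact h.tsum_log_sub_eq_inv hL hx (Ioo_subset_Icc_self hzI) ha

/-- The derivative of the Szekeres vector field is controlled by the distance to fixed points. -/
theorem exists_abs_deriv_szekeres_le (h : DiffData f g d w)
    (hL : Tendsto (fun n : ℕ => (varLogDeriv f^[n]).toReal / n) atTop (𝓝 0)) :
    ∃ C : ℝ, ∀ x ∈ Icc (0 : ℝ) 1, f x ≠ x → ∀ p ∈ Icc (0 : ℝ) 1, f p = p →
      |szekeres f d x * orbitSum f d w x| ≤ C * |x - p| := by
  obtain ⟨M, hM0, hM⟩ := h.exists_bound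
  obtain ⟨M', hM0', hM'⟩ := h.symm.exists_bound
  obtain ⟨D, hD⟩ := isCompact_Icc.exists_bound_of_continuousOn h.continuousOn_d
  have hD0 : 0 ≤ D := (norm_nonneg _).trans (hD 0 (by simp))
  -- The first summand serves fixed points ahead of `x`. The second serves those behind, where the
  -- backward sum is used and `D` compares `|f x - x|` with `|g x - x|`.
  refine ⟨Real.exp M * (M * Real.exp M) + Real.exp M * (D * (M' * Real.exp M')),
    fun x hx hfx p hp hfp => ?_⟩
  have hX := h.abs_szekeres_le hM hM0 hx
  rw [abs_mul, abs_sub_comm x p, add_mul]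
  by_cases hxp : (x ≤ p ∧ x ≤ f x) ∨ (p ≤ x ∧ f x ≤ x)
  · have h1 := h.abs_orbitSum_mul_le hM0 hM hx hfx hp hfp hxp
    have h2 : |szekeres f d x| * |orbitSum f d w x| ≤
        Real.exp M * (M * Real.exp M * |p - x|) := by
      calc _ ≤ Real.exp M * |f x - x| * |orbitSum f d w x| := by gcongr
        _ = Real.exp M * (|orbitSum f d w x| * |f x - x|) := by ring
        _ ≤ _ := by gcongr
    have h3 : 0 ≤ Real.exp M * (D * (M' * Real.exp M')) * |p - x| := by positivity
    linarith
  · have hgp : g p = p := by rw [← hfp, h.left_inv p hp, hfp]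
    have hmono := h.symm.strictMonoOn.monotoneOn
    have hxp' : (x ≤ p ∧ x ≤ g x) ∨ (p ≤ x ∧ g x ≤ x) := by
      push Not at hxp
      rcases le_total x p with hle | hle
      · exact Or.inl ⟨hle, (h.left_inv x hx).symm.trans_le
          (hmono (h.mapsTo hx) hx (hxp.1 hle).le)⟩
      · exact Or.inr ⟨hle, (hmono hx (h.mapsTo hx) (hxp.2 hle).le).trans_eq (h.left_inv x hx)⟩
    have h1 := h.symm.abs_orbitSum_mul_le hM0' hM' hx (h.inv_ne_of_ne hx hfx) hp hgp hxp'
    rw [← h.orbitSum_eq_inv hL hx hfx] at h1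
    have h4 : |f x - x| ≤ D * |g x - x| := by
      have := (convex_Icc (0 : ℝ) 1).norm_image_sub_le_of_norm_hasDerivWithin_le h.hasDeriv hD
        (h.mapsTo_inv hx) hx
      rw [h.right_inv x hx] at this
      rwa [abs_sub_comm (g x)]
    have h2 : |szekeres f d x| * |orbitSum f d w x| ≤
        Real.exp M * (D * (M' * Real.exp M' * |p - x|)) := by
      calc _ ≤ Real.exp M * |f x - x| * |orbitSum f d w x| := by gcongr
        _ ≤ Real.exp M * (D * |g x - x|) * |orbitSum f d w x| := by gcongr
        _ = Real.exp M * (D * (|orbitSum f d w x| * |g x - x|)) := by ring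
        _ ≤ _ := by gcongr
    have h3 : 0 ≤ Real.exp M * (M * Real.exp M) * |p - x| := by positivity
    linarith

/-- The Szekeres vector field of an undistorted diffeomorphism is `C^1` and flat at its zeros. -/
theorem exists_hasDerivWithinAt_szekeres (h : DiffData f g d w)
    (hL : Tendsto (fun n : ℕ => (varLogDeriv f^[n]).toReal / n) atTop (𝓝 0)) :
    ∃ Y : ℝ → ℝ, (∀ x ∈ Icc (0 : ℝ) 1, HasDerivWithinAt (szekeres f d) (Y x) (Icc 0 1) x) ∧
      ContinuousOn Y (Icc 0 1) ∧ ∀ p ∈ Icc (0 : ℝ) 1, f p = p → Y p = 0 := by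
  classical
  obtain ⟨M, hM0, hM⟩ := h.exists_bound
  obtain ⟨C, hC⟩ := h.exists_abs_deriv_szekeres_le hL
  have hpar : ∀ p ∈ Icc (0 : ℝ) 1, f p = p → d p = 1 := fun p hp hfp =>
    h.deriv_eq_one_of_fixed hL hp hfp
  set Y : ℝ → ℝ := fun x => if f x = x then 0 else -(szekeres f d x * orbitSum f d w x) with hY
  have hY0 : ∀ p, f p = p → Y p = 0 := fun p hp => by simp [hY, hp]
  have hY1 : ∀ x, f x ≠ x → Y x = -(szekeres f d x * orbitSum f d w x) :=
    fun x hx => by simp [hY, hx]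
  refine ⟨Y, fun x hx => ?_, fun x hx => ?_, fun p _ => hY0 p⟩
  · by_cases hfx : f x = x
    -- At a fixed point the field is `O(f - id)`, and `f - id` has zero derivative by parabolicity.
    · have h1 : HasDerivWithinAt (fun y => f y - y) 0 (Icc 0 1) x := by
        have := (h.hasDeriv x hx).sub (hasDerivWithinAt_id x _)
        rw [hpar x hx hfx, sub_self] at this
        exact this
      rw [hY0 x hfx, hasDerivWithinAt_iff_isLittleO]
      rw [hasDerivWithinAt_iff_isLittleO] at h1
      simp only [hfx, szekeres_of_fixed d hfx, smul_zero, sub_zero, sub_self] at h1 ⊢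
      refine Asymptotics.IsBigO.trans_isLittleO ?_ h1
      refine Asymptotics.IsBigO.of_bound (Real.exp M) ?_
      filter_upwards [self_mem_nhdsWithin] with y hy
      exact h.abs_szekeres_le hM hM0 hy
    · rw [hY1 x hfx]
      exact (h.hasDerivAt_szekeres hpar hx hfx).hasDerivWithinAt
  · by_cases hfx : f x = x
    · rw [ContinuousWithinAt, hY0 x hfx]
      have h1 : Tendsto (fun y => |C| * |y - x|) (𝓝[Icc 0 1] x) (𝓝 0) := by
        have : Continuous fun y => |C| * |y - x| := by fun_prop
        simpa using (this.tendsto x).mono_left nhdsWithin_le_nhds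
      refine squeeze_zero_norm' ?_ h1
      filter_upwards [self_mem_nhdsWithin] with y hy
      by_cases hfy : f y = y
      · rw [hY0 y hfy, norm_zero]
        positivity
      · rw [hY1 y hfy, norm_neg]
        exact (hC y hy hfy x hx hfx).trans (by gcongr; exact le_abs_self C)
    · obtain ⟨ε, hε, hball⟩ := h.exists_ball_adjacent hx hfx
      have h1 : ContinuousAt (fun y => -(szekeres f d y * orbitSum f d w y)) x :=
        ((h.hasDerivAt_szekeres hpar hx hfx).continuousAt.mul
          (h.hasDerivAt_tsum_log_sub hx hfx).2).neg
      refine (h1.congr ?_).continuousWithinAt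
      filter_upwards [Metric.ball_mem_nhds x hε] with z hz
      exact (hY1 z (hball z hz).2.1).symm

theorem szekeres_eq_zero_iff (x : ℝ) : szekeres f d x = 0 ↔ f x = x := by
  simp [szekeres, sub_eq_zero, Real.exp_ne_zero]

end DiffData
/-! ### Existence of flows on the interval -/

theorem exists_global_integralCurve {v : ℝ → ℝ} {K : NNReal} (hv : LipschitzWith K v) {B : NNReal}
    (hB : ∀ x, ‖v x‖ ≤ B) (x : ℝ) : ∃ α : ℝ → ℝ, α 0 = x ∧ ∀ t, HasDerivAt α (v (α t)) t := by
  have hloc : ∀ n : ℕ, ∃ α : ℝ → ℝ, α 0 = x ∧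
      ∀ t ∈ Ioo (-(n + 1 : ℝ)) (n + 1), HasDerivAt α (v (α t)) t := by
    intro n
    have hn : (0 : ℝ) ≤ n := n.cast_nonneg
    -- A curve of speed at most `B` travels at most `B (n + 1)` in time `n + 1`, so this radius
    -- never obstructs existence.
    have hP : IsPicardLindelof (fun _ => v) (tmin := -(n + 1 : ℝ)) (tmax := n + 1)
        ⟨0, by constructor <;> linarith⟩ x (B * (n + 1)) 0 B K :=
      .of_time_independent (fun y _ => hB y) hv.lipschitzOnWith (by simp)
    obtain ⟨α, h0, hα⟩ := hP.exists_eq_forall_mem_Icc_hasDerivWithinAt₀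
    exact ⟨α, h0, fun t ht => (hα t (Ioo_subset_Icc_self ht)).hasDerivAt (Icc_mem_nhds ht.1 ht.2)⟩
  choose α h0 hα using hloc
  have hagree : ∀ m n : ℕ, m ≤ n → ∀ t ∈ Ioo (-(m + 1 : ℝ)) (m + 1), α m t = α n t := by
    intro m n hmn t ht
    have hmn' : (m : ℝ) ≤ n := by exact_mod_cast hmn
    have hm : (0 : ℝ) ≤ m := m.cast_nonneg
    refine ODE_solution_unique_of_mem_Ioo (v := fun _ => v) (s := fun _ => univ) (K := K)
      (fun _ _ => hv.lipschitzOnWith) (t₀ := 0) ⟨by linarith, by linarith⟩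
      (fun s hs => ⟨hα m s hs, mem_univ _⟩)
      (fun s hs => ⟨hα n s ⟨by linarith [hs.1], by linarith [hs.2]⟩, mem_univ _⟩) ?_ ht
    rw [h0, h0]
  have hagree' : ∀ m n : ℕ, ∀ t : ℝ, |t| < m + 1 → |t| < n + 1 → α m t = α n t := by
    intro m n t hm hn
    rcases le_total m n with hmn | hmn
    · exact hagree m n hmn t (abs_lt.1 hm)
    · exact (hagree n m hmn t (abs_lt.1 hn)).symm
  have hceil : ∀ t : ℝ, |t| < ⌈|t|⌉₊ + 1 := fun t => (Nat.le_ceil _).trans_lt (lt_add_one _)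
  refine ⟨fun t => α ⌈|t|⌉₊ t, h0 _, fun t => ?_⟩
  refine (hα _ t (abs_lt.1 (hceil t))).congr_of_eventuallyEq ?_
  filter_upwards [continuous_abs.continuousAt.eventually (gt_mem_nhds (hceil t))] with s hs
  exact hagree' _ _ s (hceil s) hs

theorem exists_isFlowOf {X : ℝ → ℝ} {K : NNReal} (hX : LipschitzOnWith K X (Icc 0 1))
    (h0 : X 0 = 0) (h1 : X 1 = 0) : ∃ φ, IsFlowOf X φ := by
  set v : ℝ → ℝ := fun x => X (projIcc 0 1 zero_le_one x) with hvdef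
  have hv : LipschitzWith K v := by
    have := hX.to_restrict.comp (LipschitzWith.projIcc (zero_le_one (α := ℝ)))
    rwa [mul_one] at this
  have hvI : ∀ x ∈ Icc (0 : ℝ) 1, v x = X x := fun x hx => by
    simp only [hvdef, projIcc_of_mem _ hx]
  have hvO : ∀ x ∉ Icc (0 : ℝ) 1, v x = 0 := by
    intro x hx
    by_cases hx0 : 0 ≤ x
    · have : 1 ≤ x := by
        by_contra hc
        exact hx ⟨hx0, (not_le.1 hc).le⟩
      simp only [hvdef, projIcc_of_right_le _ this, h1]
    · simp only [hvdef, projIcc_of_le_left _ (not_le.1 hx0).le, h0]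
  obtain ⟨B, hB⟩ := isCompact_Icc.exists_bound_of_continuousOn hX.continuousOn
  have hB' : ∀ x, ‖v x‖ ≤ B.toNNReal := fun x =>
    (hB _ (projIcc 0 1 zero_le_one x).2).trans (Real.le_coe_toNNReal B)
  choose φ hφ0 hφ using exists_global_integralCurve hv hB'
  have hmem : ∀ t : ℝ, ∀ x ∈ Icc (0 : ℝ) 1, φ x t ∈ Icc (0 : ℝ) 1 := by
    intro t x hx
    by_contra hc
    -- Every point outside `[0,1]` is an equilibrium of the extended field, so a curve reaching one
    -- would have been constant.
    have := integralCurve_unique (s := univ) hv.lipschitzOnWith (hφ x) (fun _ => mem_univ _)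
      (β := fun _ => φ x t) (fun s => by simpa [hvO _ hc] using hasDerivAt_const s (φ x t))
      (fun _ => mem_univ _) (t₀ := t) rfl
    have h2 := congrFun this 0
    rw [hφ0] at h2
    exact hc (h2 ▸ hx)
  exact ⟨fun t x => φ x t, hmem, fun x _ => hφ0 x, fun x hx t => by
    rw [← hvI _ (hmem t x hx)]; exact hφ x t⟩

/-! ### Time-one maps -/

theorem IsFlowOf.abs_flow_sub_le {X : ℝ → ℝ} {φ : ℝ → ℝ → ℝ} (hφ : IsFlowOf X φ) {K : ℝ} (hK0 : 0 < K)
    (hK : ∀ x ∈ Icc (0 : ℝ) 1, ∀ y ∈ Icc (0 : ℝ) 1, |X y - X x| ≤ K * |y - x|) {q : ℝ}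
    (hq : q ∈ Icc (0 : ℝ) 1) {s t : ℝ} (ht : t ∈ Icc 0 s) :
    |φ t q - q| ≤ Real.exp (K * s) / K * |X q| := by
  have hd := fun t => (hφ.hasDerivAt q hq t).sub_const q
  -- Grönwall applied to `φ t q - q`, whose speed is at most `K |φ t q - q| + |X q|`.
  have h1 := norm_le_gronwallBound_of_norm_deriv_right_le (f := fun t => φ t q - q)
    (f' := fun t => X (φ t q)) (δ := 0) (K := K) (ε := |X q|) (a := 0) (b := s)
    (fun t _ => (hd t).continuousAt.continuousWithinAt) (fun t _ => (hd t).hasDerivWithinAt)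
    (by simp [hφ.zero q hq]) (fun t _ => by
      have := hK q hq _ (hφ.mem t q hq)
      rw [Real.norm_eq_abs, Real.norm_eq_abs]
      linarith [abs_sub_abs_le_abs_sub (X (φ t q)) (X q)]) t ht
  simp only [gronwallBound_of_K_ne_0 hK0.ne', Real.norm_eq_abs, sub_zero, zero_mul, zero_add] at h1
  refine h1.trans ?_
  rw [div_mul_comm]
  gcongr
  have : Real.exp (K * t) ≤ Real.exp (K * s) := Real.exp_le_exp.2 (by
    have := ht.2
    gcongr)
  linarith

/-- Near a flat zero, the flow of `X` is a translation by `s X` to first order. -/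
theorem IsFlowOf.tendsto_div {X Y : ℝ → ℝ} {φ : ℝ → ℝ → ℝ} (hφ : IsFlowOf X φ)
    (hX : ∀ x ∈ Icc (0 : ℝ) 1, HasDerivWithinAt X (Y x) (Icc 0 1) x)
    (hY : ContinuousOn Y (Icc 0 1)) {p : ℝ} (hp : p ∈ Icc (0 : ℝ) 1) (hXp : X p = 0)
    (hYp : Y p = 0) {q : ℕ → ℝ} (hqI : ∀ n, q n ∈ Icc (0 : ℝ) 1) (hq : Tendsto q atTop (𝓝 p))
    (hXq : ∀ n, X (q n) ≠ 0) {s : ℝ} (hs : 0 ≤ s) :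
    Tendsto (fun n => (φ s (q n) - q n) / X (q n)) atTop (𝓝 s) := by
  obtain ⟨K, hK⟩ := isCompact_Icc.exists_bound_of_continuousOn hY
  have hKl : ∀ x ∈ Icc (0 : ℝ) 1, ∀ y ∈ Icc (0 : ℝ) 1, |X y - X x| ≤ (|K| + 1) * |y - x| :=
    fun x hx y hy => (convex_Icc (0 : ℝ) 1).norm_image_sub_le_of_norm_hasDerivWithin_le hX
      (fun z hz => (hK z hz).trans (by linarith [le_abs_self K])) hx hy
  have hK0 : 0 < |K| + 1 := by positivity
  set C := Real.exp ((|K| + 1) * s) / (|K| + 1) with hC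
  have hC0 : 0 < C := by positivity
  have hXt : Tendsto (fun n => C * |X (q n)|) atTop (𝓝 0) := by
    have := ((hX p hp).continuousWithinAt.tendsto.comp (tendsto_nhdsWithin_iff.2
      ⟨hq, Eventually.of_forall hqI⟩)).abs.const_mul C
    simpa [hXp] using this
  rw [Metric.tendsto_atTop']
  intro η hη
  -- The final error is `s · η₁ · C · |X (q n)|`; the added 1 keeps the denominator positive and
  -- makes the bound strictly less than `η |X (q n)|`.
  set η₁ := η / (s * C + 1) with hη₁
  have hsC : 0 < s * C + 1 := by positivity
  have hη₁0 : 0 < η₁ := by positivity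
  obtain ⟨δ, hδ, hball⟩ := Metric.continuousWithinAt_iff.1 (hY p hp) η₁ hη₁0
  have h1 := hq.eventually (Metric.ball_mem_nhds p (half_pos hδ))
  have h2 := hXt.eventually (gt_mem_nhds (half_pos hδ))
  obtain ⟨N, hN⟩ := eventually_atTop.1 (h1.and h2)
  refine ⟨N, fun n hn => ?_⟩
  obtain ⟨hqn, hXn⟩ := hN n hn.le
  have hclose : ∀ t ∈ Icc 0 s, |φ t (q n) - q n| ≤ C * |X (q n)| := fun t ht =>
    hφ.abs_flow_sub_le hK0 hKl (hqI n) ht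
  have hconv : Convex ℝ (Icc (0 : ℝ) 1 ∩ Metric.ball p δ) :=
    (convex_Icc 0 1).inter (convex_ball p δ)
  have hdiff : ∀ t ∈ Icc 0 s, |X (φ t (q n)) - X (q n)| ≤ η₁ * (C * |X (q n)|) := by
    intro t ht
    rw [Real.dist_eq] at hqn
    have hφI : φ t (q n) ∈ Icc (0 : ℝ) 1 ∩ Metric.ball p δ := by
      refine ⟨hφ.mem t _ (hqI n), ?_⟩
      rw [Metric.mem_ball, Real.dist_eq]
      have := abs_sub_le (φ t (q n)) (q n) p
      linarith [hclose t ht]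
    have hqI' : q n ∈ Icc (0 : ℝ) 1 ∩ Metric.ball p δ := by
      refine ⟨hqI n, ?_⟩
      rw [Metric.mem_ball, Real.dist_eq]
      linarith
    refine (hconv.norm_image_sub_le_of_norm_hasDerivWithin_le (f := X) (f' := Y)
      (fun z hz => (hX z hz.1).mono inter_subset_left) (C := η₁) (fun z hz => ?_) hqI' hφI).trans ?_
    · have := hball hz.1 hz.2
      rw [Real.dist_eq, hYp, sub_zero] at this
      exact this.le
    · exact mul_le_mul_of_nonneg_left (hclose t ht) hη₁0.le
  -- The mean value inequality in time for `φ t q - t X q`: along the short orbit `X` is nearly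
  -- constant, because `Y` is small near `p`.
  have hmv := norm_image_sub_le_of_norm_deriv_le_segment'
    (f := fun t => φ t (q n) - t * X (q n)) (f' := fun t => X (φ t (q n)) - X (q n)) (a := 0)
    (b := s) (C := η₁ * (C * |X (q n)|))
    (fun t _ => by
      have := (hφ.hasDerivAt _ (hqI n) t).sub ((hasDerivAt_id t).mul_const (X (q n)))
      rw [one_mul] at this
      exact this.hasDerivWithinAt)
    (fun t ht => hdiff t (Ico_subset_Icc_self ht)) s (right_mem_Icc.2 hs)
  simp only [hφ.zero _ (hqI n), zero_mul, sub_zero] at hmv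
  have hXpos : 0 < |X (q n)| := abs_pos.2 (hXq n)
  have heq : (φ s (q n) - q n) / X (q n) - s = (φ s (q n) - s * X (q n) - q n) / X (q n) := by
    have := hXq n
    field_simp
    ring
  rw [Real.dist_eq, heq, abs_div, div_lt_iff₀ hXpos]
  rw [Real.norm_eq_abs] at hmv
  refine hmv.trans_lt ?_
  have h3 : η₁ * (s * C + 1) = η := div_mul_cancel₀ _ hsC.ne'
  nlinarith [mul_pos hη₁0 hXpos]

namespace DiffData
variable {f g d w : ℝ → ℝ} {x : ℝ}

theorem iterate_flow (h : DiffData f g d w) {X : ℝ → ℝ} {φ : ℝ → ℝ → ℝ} (hφ : IsFlowOf X φ)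
    {K : NNReal} (hK : LipschitzOnWith K X (Icc 0 1))
    (hinv : ∀ x ∈ Icc (0 : ℝ) 1, X (f x) = d x * X x) (hx : x ∈ Icc (0 : ℝ) 1) (t : ℝ) (n : ℕ) :
    f^[n] (φ t x) = φ t (f^[n] x) := by
  have hone : ∀ y ∈ Icc (0 : ℝ) 1, f (φ t y) = φ t (f y) := by
    intro y hy
    -- By invariance both sides are integral curves of `X` issuing from `f y`.
    have := integralCurve_unique hK (α := fun t => f (φ t y)) (β := fun t => φ t (f y))
      (fun t => by
        rw [hinv _ (hφ.mem t y hy)]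
        exact (h.hasDeriv _ (hφ.mem t y hy)).comp_hasDerivAt t (hφ.hasDerivAt y hy t)
          (Eventually.of_forall fun s => hφ.mem s y hy))
      (fun t => h.mapsTo (hφ.mem t y hy)) (hφ.hasDerivAt _ (h.mapsTo hy))
      (fun t => hφ.mem t _ (h.mapsTo hy)) (t₀ := 0)
      (by simp only [hφ.zero y hy, hφ.zero _ (h.mapsTo hy)])
    exact congrFun this t
  induction n with
  | zero => rfl
  | succ n ih =>
    rw [Function.iterate_succ_apply', Function.iterate_succ_apply', ih,
      hone _ (h.iterate_mem n hx)]

theorem isTimeOneMap_szekeres (h : DiffData f g d w)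
    (hL : Tendsto (fun n : ℕ => (varLogDeriv f^[n]).toReal / n) atTop (𝓝 0)) :
    ContDiffOn ℝ 1 (szekeres f d) (Icc 0 1) ∧ IsTimeOneMap (szekeres f d) f ∧
      ∀ p ∈ Icc (0 : ℝ) 1, szekeres f d p = 0 → IsC1FlatAt (szekeres f d) p := by
  obtain ⟨Y, hX, hYc, hY0⟩ := h.exists_hasDerivWithinAt_szekeres hL
  have hderiv : ∀ x ∈ Icc (0 : ℝ) 1, derivWithin (szekeres f d) (Icc 0 1) x = Y x :=
    fun x hx => (hX x hx).derivWithin (uniqueDiffWithinAt_unit hx)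
  have hC1 : ContDiffOn ℝ 1 (szekeres f d) (Icc 0 1) :=
    (contDiffOn_one_iff_derivWithin (uniqueDiffOn_Icc zero_lt_one)).2
      ⟨fun x hx => (hX x hx).differentiableWithinAt, hYc.congr hderiv⟩
  refine ⟨hC1, ?_, fun p hp hp0 => ⟨hp0, ?_⟩⟩
  swap
  · rw [hderiv p hp, hY0 p hp ((szekeres_eq_zero_iff p).1 hp0)]
  obtain ⟨K, hK⟩ := lipschitzOnWith_of_contDiffOn hC1
  obtain ⟨φ, hφ⟩ := exists_isFlowOf hK (szekeres_of_fixed d h.map_zero)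
    (szekeres_of_fixed d h.map_one)
  refine ⟨φ, hφ, fun x hx => ?_⟩
  by_cases hfx : f x = x
  · rw [hfx, hφ.flow_eq_self hK hx (szekeres_of_fixed d hfx)]
  obtain ⟨p, hpI, hfp, hp⟩ := h.exists_tendsto_iterate hx
  have hcomm : ∀ n, f (f^[n] x) = f^[n] (f x) := fun n => by
    rw [← Function.iterate_succ_apply, Function.iterate_succ_apply']
  have hne : ∀ n, szekeres f d (f^[n] x) ≠ 0 := fun n hc => by
    rw [szekeres_eq_zero_iff, hcomm] at hc
    exact h.iterate_map_sub_ne_zero hx hfx n (sub_eq_zero.2 hc)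
  -- Pushed along the orbit, where the flow is `s X` to first order and `X` is asymptotic to the
  -- displacement, `φ s x` sits at the fraction `s` of the interval from `x` to `f x`.
  have hlim : ∀ s : ℝ, 0 ≤ s → Tendsto (fun n => (f^[n] (φ s x) - f^[n] x) /
      (f^[n] (f x) - f^[n] x)) atTop (𝓝 s) := by
    intro s hs
    have h1 := hφ.tendsto_div hX hYc hpI (szekeres_of_fixed d hfp) (hY0 p hpI hfp)
      (fun n => h.iterate_mem n hx) hp hne hs
    have h2 := h1.mul (h.tendsto_szekeres_iterate_div hx hfx)
    rw [mul_one] at h2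
    refine h2.congr fun n => ?_
    rw [h.iterate_flow hφ hK (fun y hy => h.szekeres_map hy) hx, div_mul_div_cancel₀ (hne n)]
  have hlt : ∀ (n : ℕ) (a b : ℝ), a ∈ Icc (0 : ℝ) 1 → b ∈ Icc (0 : ℝ) 1 →
      (f^[n] a < f^[n] b ↔ a < b) := fun n a b ha hb =>
    (h.strictMonoOn_iterate n).lt_iff_lt ha hb
  have hfxI := h.mapsTo hx
  -- The fraction exceeds 1 at some time `n`, and the monotone `f^[n]` reflects order, so `φ s x` is
  -- not short of `f x`. The case `s < 1` is opposite, and continuity at `s = 1` leaves only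
  -- equality.
  have hgt1 : ∀ s : ℝ, 1 < s → 0 ≤ (φ s x - f x) * (f x - x) := by
    intro s hs
    obtain ⟨n, hn⟩ := ((hlim s (by linarith)).eventually (lt_mem_nhds hs)).exists
    rcases lt_or_gt_of_ne hfx with hc | hc
    · have h1 := (hlt n _ _ hfxI hx).2 hc
      rw [lt_div_iff_of_neg (sub_neg.2 h1), one_mul, sub_lt_sub_iff_right,
        hlt n _ _ (hφ.mem s x hx) hfxI] at hn
      exact mul_nonneg_of_nonpos_of_nonpos (by linarith) (by linarith)
    · have h1 := (hlt n _ _ hx hfxI).2 hc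
      rw [lt_div_iff₀ (sub_pos.2 h1), one_mul, sub_lt_sub_iff_right,
        hlt n _ _ hfxI (hφ.mem s x hx)] at hn
      exact mul_nonneg (by linarith) (by linarith)
  have hlt1 : ∀ s : ℝ, 0 < s → s < 1 → (φ s x - f x) * (f x - x) ≤ 0 := by
    intro s hs0 hs
    obtain ⟨n, hn⟩ := ((hlim s hs0.le).eventually (gt_mem_nhds hs)).exists
    rcases lt_or_gt_of_ne hfx with hc | hc
    · have h1 := (hlt n _ _ hfxI hx).2 hc
      rw [div_lt_iff_of_neg (sub_neg.2 h1), one_mul, sub_lt_sub_iff_right,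
        hlt n _ _ hfxI (hφ.mem s x hx)] at hn
      exact mul_nonpos_of_nonneg_of_nonpos (by linarith) (by linarith)
    · have h1 := (hlt n _ _ hx hfxI).2 hc
      rw [div_lt_iff₀ (sub_pos.2 h1), one_mul, sub_lt_sub_iff_right,
        hlt n _ _ (hφ.mem s x hx) hfxI] at hn
      exact mul_nonpos_of_nonpos_of_nonneg (by linarith) (by linarith)
  have hcont : ContinuousAt (fun s => (φ s x - f x) * (f x - x)) 1 :=
    (((hφ.hasDerivAt x hx 1).continuousAt).sub continuousAt_const).mul continuousAt_const
  have hge : 0 ≤ (φ 1 x - f x) * (f x - x) := by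
    refine ge_of_tendsto (hcont.tendsto.mono_left (nhdsWithin_le_nhds (s := Ioi 1))) ?_
    filter_upwards [self_mem_nhdsWithin] with s hs using hgt1 s hs
  have hle : (φ 1 x - f x) * (f x - x) ≤ 0 := by
    refine le_of_tendsto (hcont.tendsto.mono_left (nhdsWithin_le_nhds (s := Iio 1))) ?_
    filter_upwards [Ioo_mem_nhdsLT zero_lt_one] with s hs using hlt1 s hs.1 hs.2
  have h0 := le_antisymm hle hge
  rcases mul_eq_zero.1 h0 with h1 | h1
  · exact (sub_eq_zero.1 h1).symm
  · exact absurd (sub_eq_zero.1 h1) hfx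

end DiffData
end IntervalDiffeo

theorem corollaryC (f : ℝ → ℝ) (hf : IsDiffPlus 2 f) :
    Tendsto (distortionSeq f) atTop (𝓝 (asymptoticDistortion f)) ∧
    asymptoticDistortion f ≠ ⊤ ∧
    (asymptoticDistortion f = 0 ↔
      ∃ X : ℝ → ℝ, ContDiffOn ℝ 1 X (Icc 0 1) ∧ IsTimeOneMap X f ∧
        ∀ p ∈ Icc (0 : ℝ) 1, X p = 0 → IsC1FlatAt X p) := by
  obtain ⟨g, w, h⟩ := hf.exists_diffData
  obtain ⟨L, hL0, hL, hT⟩ := h.exists_tendsto_distortionSeq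
  have hA : asymptoticDistortion f = ENNReal.ofReal L := hT.limUnder_eq
  rw [hA]
  refine ⟨hT, ENNReal.ofReal_ne_top, ?_⟩
  rw [ENNReal.ofReal_eq_zero]
  constructor
  · intro hle
    rw [le_antisymm hle hL0] at hL
    exact ⟨_, h.isTimeOneMap_szekeres hL⟩
  · rintro ⟨X, hX, hXf, hflat⟩
    exact (h.tendsto_zero_of_timeOneMap hX hXf hflat hL0 hL).le
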